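/- Let $\mathcal F$ be the CAR algebra of the lattice $\mathbb Z$, i.e. the $C^*$-algebra generated by elements $c_j$ ($j\in\mathbb Z$) with $\{c_i,c_j\}=0$ and $\{c_i^*,c_j\}=\delta_{ij}1$. Let $\Theta$ and $\Theta_-$ be the automorphisms of $\mathcal F$ with $\Theta(c_j)=-c_j$ for all $j$, and $\Theta_-(c_j)=c_j$ for $j\ge 1$, $\Theta_-(c_j)=-c_j$ for $j\le 0$, and put $\mathcal F_\pm=\{A\in\mathcal F:\Theta(A)=\pm A\}$. Let $\tau^{f}_n$ ($n\in\mathbb Z$) be the shift automorphisms of $\mathcal F$, $\tau^{f}_n(c_j)=c_{j+n}$. Let $T=T^*$, $T^2=1$, be the unitary that implements $\Theta_-$ in the crossed product $C^*$-algebra $\mathcal F\rtimes_{\Theta_-}\mathbb Z/2$, so that $TAT=\Theta_-(A)$ for $A\in\mathcal F$. The algebra of the spin-$\tfrac12$ chain is $\mathcal A=\mathcal F_+ + T\mathcal F_-$; it is generated by the Pauli matrices $$\sigma^z_j=2c_j^*c_j-1,\qquad \sigma^x_j=TS^{(j)}(c_j+c_j^*),\qquad \sigma^y_j=iTS^{(j)}(c_j-c_j^*)\qquad(j\in\mathbb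 Z),$$ where $S^{(j)}=\sigma^z_1\cdots\sigma^z_{j-1}$ for $j\ge 2$, $S^{(1)}=1$, and $S^{(j)}=\sigma^z_0\cdots\sigma^z_j$ for $j\le 0$. Let $\tau^{s}_n$ ($n\in\mathbb Z$) be the shift automorphisms of $\mathcal A$, $\tau^{s}_n(\sigma^a_j)=\sigma^a_{j+n}$ for $a=x,y,z$. A $C^*$-flow is a strongly continuous one-parameter group $(\alpha_t)_{t\in\mathbb R}$ of $*$-automorphisms. The graded commutator $[\cdot,\cdot]_\Theta$ on $\mathcal F$ is the bilinear map with $[A,B]_\Theta=AB+BA$ for $A,B\in\mathcal F_-$, and $[A,B]_\Theta=AB-BA$ if $A,B\in\mathcal F_+\cup\mathcal F_-$ and at least one of them lies in $\mathcal F_+$. 1. If $(\alpha_t)_{t\in\mathbb R}$ is a $C^*$-flow on $\mathcal A$ with $\alpha_n=\tau^{s}_n$ for all $n\in\mathbb Z$, then it is norm asymptotically abelian: $\lim_{|t|\to\infty}\|[A,\alpha_t(B)]\|=0$ for all $A,B\in\mathcal A$. 2. If $(\alpha_t)_{t\in\mathbb R}$ is a $C^*$-flow on $\mathcal F$ with $\alpha_n=\tau^{f}_n$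 for all $n\in\mathbb Z$, then it is norm $\Theta$-graded asymptotically abelian: $\lim_{|t|\to\infty}\|[A,\alpha_t(B)]_\Theta\|=0$ for all $A,B\in\mathcal F$. -/

import Mathlib

noncomputable section

namespace QuantumChain

open scoped ComplexConjugate symmDiff

/-- The square-summable functions on the finite subsets of `ℤ`: fermionic Fock space over `ℓ²(ℤ)`
in the occupation-number basis. -/
abbrev Fock : Type := lp (fun _ : Finset ℤ => ℂ) 2

theorem weightedComp_memℓp (e : Equiv.Perm (Finset ℤ)) (m : Finset ℤ → ℂ) (hm : ∀ S, ‖m S‖ ≤ 1)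
    (f : Fock) : Memℓp (fun S => m S * f (e S)) 2 := by
  have h2 : (0 : ℝ) < (2 : ENNReal).toReal := by norm_num
  have hf : Summable fun S => ‖f S‖ ^ (2 : ENNReal).toReal := (lp.memℓp f).summable h2
  refine memℓp_gen (Summable.of_nonneg_of_le (fun S => by positivity) (fun S => ?_)
    (e.summable_iff.2 hf))
  refine Real.rpow_le_rpow (norm_nonneg _) ?_ h2.le
  rw [norm_mul]
  exact mul_le_of_le_one_left (norm_nonneg _) (hm S)

/-- The bounded operator `(W f)(S) = m(S) f(e(S))` on Fock space, for a permutation `e` of the basis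
and weights `m` bounded by one. -/
def weightedComp (e : Equiv.Perm (Finset ℤ)) (m : Finset ℤ → ℂ) (hm : ∀ S, ‖m S‖ ≤ 1) :
    Fock →L[ℂ] Fock :=
  LinearMap.mkContinuous
    { toFun := fun f => ⟨fun S => m S * f (e S), weightedComp_memℓp e m hm f⟩
      map_add' := fun f g => by ext S; exact mul_add _ _ _
      map_smul' := fun a f => by ext S; exact mul_left_comm _ _ _ }
    1 (fun f => by
      have h2 : (0 : ℝ) < (2 : ENNReal).toReal := by norm_num
      have hf : Summable fun S => ‖f S‖ ^ (2 : ENNReal).toReal := (lp.memℓp f).summable h2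
      rw [one_mul, lp.norm_eq_tsum_rpow h2, lp.norm_eq_tsum_rpow h2 f,
        ← e.tsum_eq (fun S => ‖f S‖ ^ (2 : ENNReal).toReal)]
      have hle : ∀ S, ‖m S * f (e S)‖ ^ (2 : ENNReal).toReal ≤ ‖f (e S)‖ ^ (2 : ENNReal).toReal := by
        intro S
        refine Real.rpow_le_rpow (norm_nonneg _) ?_ h2.le
        rw [norm_mul]
        exact mul_le_of_le_one_left (norm_nonneg _) (hm S)
      refine Real.rpow_le_rpow (tsum_nonneg fun S => by positivity) ?_ (by positivity)
      exact Summable.tsum_le_tsum hle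
        (Summable.of_nonneg_of_le (fun S => by positivity) hle (e.summable_iff.2 hf))
        (e.summable_iff.2 hf))

theorem weightedComp_apply (e : Equiv.Perm (Finset ℤ)) (m : Finset ℤ → ℂ) (hm : ∀ S, ‖m S‖ ≤ 1)
    (f : Fock) (S : Finset ℤ) : weightedComp e m hm f S = m S * f (e S) := rfl

theorem star_weightedComp (e : Equiv.Perm (Finset ℤ)) (m : Finset ℤ → ℂ) (hm : ∀ S, ‖m S‖ ≤ 1) :
    star (weightedComp e m hm) =
      weightedComp e.symm (fun S => conj (m (e.symm S))) (fun S => by simpa using hm _) := by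
  rw [ContinuousLinearMap.star_eq_adjoint]
  symm
  rw [ContinuousLinearMap.eq_adjoint_iff]
  intro f g
  rw [lp.inner_eq_tsum, lp.inner_eq_tsum, ← e.tsum_eq]
  refine tsum_congr fun S => ?_
  simp [weightedComp_apply]
  ring

theorem op_ext {A B : Fock →L[ℂ] Fock} (h : ∀ (f : Fock) (S : Finset ℤ), A f S = B f S) : A = B :=
  ContinuousLinearMap.ext fun f => lp.ext (funext (h f))

theorem mul_app (A B : Fock →L[ℂ] Fock) (f : Fock) (S : Finset ℤ) : (A * B) f S = A (B f) S := rfl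

theorem add_app (A B : Fock →L[ℂ] Fock) (f : Fock) (S : Finset ℤ) :
    (A + B) f S = A f S + B f S := rfl

theorem smul_app (a : ℂ) (A : Fock →L[ℂ] Fock) (f : Fock) (S : Finset ℤ) :
    (a • A) f S = a * A f S := rfl

theorem one_app (f : Fock) (S : Finset ℤ) : (1 : Fock →L[ℂ] Fock) f S = f S := rfl

theorem zero_app (f : Fock) (S : Finset ℤ) : (0 : Fock →L[ℂ] Fock) f S = 0 := rfl

/-- The sign `(-1)^n`, `n` being the number of elements of `S` that satisfy `p`. -/
def countSign (p : ℤ → Prop) [DecidablePred p] (S : Finset ℤ) : ℂ := (-1) ^ (S.filter p).card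

theorem norm_countSign (p : ℤ → Prop) [DecidablePred p] (S : Finset ℤ) : ‖countSign p S‖ = 1 := by
  simp [countSign]

theorem countSign_mul_self (p : ℤ → Prop) [DecidablePred p] (S : Finset ℤ) :
    countSign p S * countSign p S = 1 := by
  rw [countSign, ← mul_pow]; simp

theorem conj_countSign (p : ℤ → Prop) [DecidablePred p] (S : Finset ℤ) :
    conj (countSign p S) = countSign p S := by
  simp [countSign]

/-- The permutation `S ↦ S ∆ {j}` of the basis, which flips the occupation of the site `j`. -/
def flip (j : ℤ) : Equiv.Perm (Finset ℤ) where
  toFun S := S ∆ {j}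
  invFun S := S ∆ {j}
  left_inv S := by simp
  right_inv S := by simp

theorem flip_apply (j : ℤ) (S : Finset ℤ) : flip j S = S ∆ {j} := rfl

theorem mem_flip (i j : ℤ) (S : Finset ℤ) : i ∈ flip j S ↔ (i ∈ S ↔ i ≠ j) := by
  rw [flip_apply, Finset.mem_symmDiff, Finset.mem_singleton]; tauto

theorem flip_flip (j : ℤ) (S : Finset ℤ) : flip j (flip j S) = S := by simp [flip_apply]

theorem flip_symm (j : ℤ) : (flip j).symm = flip j := rfl

theorem flip_comm (i j : ℤ) (S : Finset ℤ) : flip i (flip j S) = flip j (flip i S) := by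
  simp only [flip_apply]; rw [symmDiff_right_comm]

theorem countSign_flip (p : ℤ → Prop) [DecidablePred p] (j : ℤ) (S : Finset ℤ) :
    countSign p (flip j S) = (if p j then -1 else 1) * countSign p S := by
  by_cases hj : j ∈ S
  · have h1 : flip j S = S.erase j := by
      ext i; rw [mem_flip, Finset.mem_erase]; by_cases h : i = j <;> simp [h, hj]
    rw [h1, countSign, countSign, Finset.filter_erase]
    split_ifs with hp
    · have : j ∈ S.filter p := Finset.mem_filter.2 ⟨hj, hp⟩
      rw [← Finset.card_erase_add_one this, pow_succ]; ring
    · rw [Finset.erase_eq_of_notMem (by simp [hp]), one_mul]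
  · have h1 : flip j S = insert j S := by
      ext i; rw [mem_flip, Finset.mem_insert]; by_cases h : i = j <;> simp [h, hj]
    rw [h1, countSign, countSign, Finset.filter_insert]
    split_ifs with hp
    · rw [Finset.card_insert_of_notMem (by simp [hj]), pow_succ]; ring
    · rw [one_mul]

/-- The annihilation operator at the site `j` in the occupation-number basis:
it sends `δ_S` to `(-1)^{#{k ∈ S, k < j}} δ_{S \ {j}}` if `j ∈ S`, and to `0` otherwise. -/
def annihilator (j : ℤ) : Fock →L[ℂ] Fock :=
  weightedComp (flip j) (fun S => if j ∈ S then 0 else countSign (· < j) S) (fun S => by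
    split_ifs
    · simp
    · exact (norm_countSign _ _).le)

theorem annihilator_apply (j : ℤ) (f : Fock) (S : Finset ℤ) :
    annihilator j f S = (if j ∈ S then 0 else countSign (· < j) S) * f (flip j S) := rfl

theorem star_annihilator_apply (j : ℤ) (f : Fock) (S : Finset ℤ) :
    star (annihilator j) f S = (if j ∈ S then countSign (· < j) S else 0) * f (flip j S) := by
  rw [annihilator, star_weightedComp, weightedComp_apply, flip_symm]
  congr 1
  by_cases h : j ∈ S <;> simp [mem_flip, h, countSign_flip, conj_countSign]

/-- The canonical anticommutation relations. -/
theorem annihilator_anticomm (i j : ℤ) :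
    annihilator i * annihilator j + annihilator j * annihilator i = 0 := by
  refine op_ext fun f S => ?_
  simp only [add_app, mul_app, annihilator_apply, zero_app,
    countSign_flip, mem_flip]
  rcases lt_trichotomy i j with h | h | h
  · rw [flip_comm j i]
    by_cases hi : i ∈ S <;> by_cases hj : j ∈ S <;> simp [hi, hj, h, h.ne, h.ne', h.not_gt]; ring
  · subst h; by_cases hi : i ∈ S <;> simp [hi]
  · rw [flip_comm j i]
    by_cases hi : i ∈ S <;> by_cases hj : j ∈ S <;> simp [hi, hj, h, h.ne, h.ne', h.not_gt]; ring

theorem star_annihilator_anticomm (i j : ℤ) :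
    star (annihilator i) * annihilator j + annihilator j * star (annihilator i) =
      if i = j then 1 else 0 := by
  refine op_ext fun f S => ?_
  simp only [add_app, mul_app, annihilator_apply, star_annihilator_apply, countSign_flip, mem_flip]
  rcases lt_trichotomy i j with h | h | h
  · rw [flip_comm j i]
    by_cases hi : i ∈ S <;> by_cases hj : j ∈ S <;> simp [hi, hj, h, h.ne, h.ne', h.not_gt]; ring
  · subst h
    have := countSign_mul_self (· < i) S
    by_cases hi : i ∈ S <;> simp [hi, flip_flip] <;> rw [← mul_assoc, this, one_mul]
  · rw [flip_comm j i]
    by_cases hi : i ∈ S <;> by_cases hj : j ∈ S <;> simp [hi, hj, h, h.ne, h.ne', h.not_gt]; ring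

/-- The unitary `(-1)^{N_p}`, where `N_p` counts the particles at the sites that satisfy `p`. -/
def signOp (p : ℤ → Prop) [DecidablePred p] : Fock →L[ℂ] Fock :=
  weightedComp (Equiv.refl _) (countSign p) (fun S => (norm_countSign p S).le)

theorem signOp_apply (p : ℤ → Prop) [DecidablePred p] (f : Fock) (S : Finset ℤ) :
    signOp p f S = countSign p S * f S := rfl

theorem star_signOp (p : ℤ → Prop) [DecidablePred p] : star (signOp p) = signOp p := by
  rw [signOp, star_weightedComp]
  refine op_ext fun f S => ?_
  simp [weightedComp_apply, conj_countSign]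

theorem signOp_mul_self (p : ℤ → Prop) [DecidablePred p] : signOp p * signOp p = 1 := by
  refine op_ext fun f S => ?_
  simp [signOp_apply, ← mul_assoc, countSign_mul_self]

theorem signOp_comm (p q : ℤ → Prop) [DecidablePred p] [DecidablePred q] :
    signOp p * signOp q = signOp q * signOp p := by
  refine op_ext fun f S => ?_
  simp [signOp_apply]; ring

/-- The operator `(-1)^{N_p}` as a unitary. -/
def signUnitary (p : ℤ → Prop) [DecidablePred p] : unitary (Fock →L[ℂ] Fock) :=
  ⟨signOp p, by rw [Unitary.mem_iff, star_signOp, signOp_mul_self]; simp⟩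

theorem signOp_conj_annihilator (p : ℤ → Prop) [DecidablePred p] (j : ℤ) :
    signOp p * annihilator j * signOp p = (if p j then -1 else 1 : ℂ) • annihilator j := by
  refine op_ext fun f S => ?_
  have := countSign_mul_self p S
  simp only [mul_app, signOp_apply, annihilator_apply, countSign_flip,
    smul_app]
  linear_combination ((if p j then -1 else 1 : ℂ) * (if j ∈ S then 0 else countSign (· < j) S)
    * f (flip j S)) * this

/-- The permutation `S ↦ S - n` of the basis. -/
def shiftPerm (n : ℤ) : Equiv.Perm (Finset ℤ) := Equiv.finsetCongr (Equiv.subRight n)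

theorem mem_shiftPerm (n i : ℤ) (S : Finset ℤ) : i ∈ shiftPerm n S ↔ i + n ∈ S := by
  simp [shiftPerm, Equiv.finsetCongr_apply, Finset.mem_map_equiv]

theorem shiftPerm_add (m n : ℤ) (S : Finset ℤ) :
    shiftPerm m (shiftPerm n S) = shiftPerm (m + n) S := by
  ext i; simp [mem_shiftPerm, add_assoc]

theorem shiftPerm_zero (S : Finset ℤ) : shiftPerm 0 S = S := by
  ext i; simp [mem_shiftPerm]

theorem shiftPerm_symm (n : ℤ) : (shiftPerm n).symm = shiftPerm (-n) := by
  ext1 S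
  rw [Equiv.symm_apply_eq, shiftPerm_add, add_neg_cancel, shiftPerm_zero]

theorem countSign_shiftPerm (p : ℤ → Prop) [DecidablePred p] (n : ℤ) (S : Finset ℤ) :
    countSign p (shiftPerm n S) = countSign (fun i => p (i - n)) S := by
  rw [countSign, countSign]
  congr 1
  have : (shiftPerm n S).filter p = shiftPerm n (S.filter fun i => p (i - n)) := by
    ext i; simp [mem_shiftPerm]
  rw [this]
  simp [shiftPerm, Equiv.finsetCongr_apply]

theorem shiftPerm_flip (n j : ℤ) (S : Finset ℤ) :
    shiftPerm n (flip (j + n) S) = flip j (shiftPerm n S) := by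
  ext i; simp [mem_shiftPerm, mem_flip]

/-- The unitary on Fock space that translates all particles by `n` sites: `δ_S ↦ δ_{S + n}`. -/
def shiftOp (n : ℤ) : Fock →L[ℂ] Fock :=
  weightedComp (shiftPerm n) (fun _ => 1) (fun _ => by simp)

theorem shiftOp_apply (n : ℤ) (f : Fock) (S : Finset ℤ) :
    shiftOp n f S = f (shiftPerm n S) := by
  rw [shiftOp, weightedComp_apply, one_mul]

theorem star_shiftOp (n : ℤ) : star (shiftOp n) = shiftOp (-n) := by
  rw [shiftOp, star_weightedComp]
  refine op_ext fun f S => ?_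
  simp [weightedComp_apply, shiftOp_apply, shiftPerm_symm]

theorem shiftOp_mul (m n : ℤ) : shiftOp m * shiftOp n = shiftOp (m + n) := by
  refine op_ext fun f S => ?_
  simp [shiftOp_apply, shiftPerm_add, add_comm]

theorem shiftOp_zero : shiftOp 0 = 1 := by
  refine op_ext fun f S => ?_
  simp [shiftOp_apply, shiftPerm_zero]

/-- The translation of all particles by `n` sites as a unitary. -/
def shiftUnitary (n : ℤ) : unitary (Fock →L[ℂ] Fock) :=
  ⟨shiftOp n, by rw [Unitary.mem_iff, star_shiftOp, shiftOp_mul, shiftOp_mul]; simp [shiftOp_zero]⟩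

theorem shiftOp_conj_annihilator (n j : ℤ) :
    shiftOp n * annihilator j * shiftOp (-n) = annihilator (j + n) := by
  refine op_ext fun f S => ?_
  simp only [mul_app, shiftOp_apply, annihilator_apply, mem_shiftPerm,
    countSign_shiftPerm, ← shiftPerm_flip, shiftPerm_add, neg_add_cancel, shiftPerm_zero,
    sub_lt_iff_lt_add]

theorem shiftOp_conj_signOp (n : ℤ) (p : ℤ → Prop) [DecidablePred p] :
    shiftOp n * signOp p * shiftOp (-n) = signOp (fun i => p (i - n)) := by
  refine op_ext fun f S => ?_
  simp only [mul_app, shiftOp_apply, signOp_apply,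
    countSign_shiftPerm, shiftPerm_add, neg_add_cancel, shiftPerm_zero]

theorem coe_signUnitary (p : ℤ → Prop) [DecidablePred p] :
    (signUnitary p : Fock →L[ℂ] Fock) = signOp p := rfl

theorem coe_shiftUnitary (n : ℤ) : (shiftUnitary n : Fock →L[ℂ] Fock) = shiftOp n := rfl

/-- Conjugation by a unitary, `x ↦ u x u*`, as an automorphism of a star subalgebra that it and its
inverse leave invariant. -/
def conjAut {B : Type*} [Ring B] [StarRing B] [Algebra ℂ B] [StarModule ℂ B]
    (D : StarSubalgebra ℂ B) (u : unitary B)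
    (h : ∀ x ∈ D, (u : B) * x * star (u : B) ∈ D) (h' : ∀ x ∈ D, star (u : B) * x * u ∈ D) :
    D ≃⋆ₐ[ℂ] D where
  toFun x := ⟨u * x * star (u : B), h x x.2⟩
  invFun x := ⟨star (u : B) * x * u, h' x x.2⟩
  left_inv x := Subtype.ext (by
    have := Unitary.coe_star_mul_self u
    calc star (u : B) * (u * x * star (u : B)) * u
        = (star (u : B) * u) * x * (star (u : B) * u) := by simp only [mul_assoc]
      _ = x := by rw [this, one_mul, mul_one])
  right_inv x := Subtype.ext (by
    have : (u : B) * star (u : B) = 1 := Unitary.coe_mul_star_self u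
    calc (u : B) * (star (u : B) * x * u) * star (u : B)
        = (u * star (u : B)) * x * (u * star (u : B)) := by simp only [mul_assoc]
      _ = x := by rw [this, one_mul, mul_one])
  map_mul' x y := Subtype.ext (by
    have := Unitary.coe_star_mul_self u
    calc (u : B) * (x * y) * star (u : B)
        = u * x * 1 * y * star (u : B) := by simp only [mul_assoc, one_mul]
      _ = u * x * star (u : B) * (u * y * star (u : B)) := by
          rw [← this]; simp only [mul_assoc])
  map_add' x y := Subtype.ext (by simp [mul_add, add_mul])
  map_star' x := Subtype.ext (by simp [mul_assoc])
  map_smul' a x := Subtype.ext (by simp)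

/-- The CAR algebra over `ℤ`: the norm closure of the star algebra generated by all the annihilation
operators. -/
def CARAlgebra : StarSubalgebra ℂ (Fock →L[ℂ] Fock) :=
  (StarAlgebra.adjoin ℂ (Set.range annihilator)).topologicalClosure

theorem annihilator_mem (j : ℤ) : annihilator j ∈ CARAlgebra :=
  StarSubalgebra.le_topologicalClosure _ (StarAlgebra.subset_adjoin ℂ _ ⟨j, rfl⟩)

theorem conj_mem_CARAlgebra (u : unitary (Fock →L[ℂ] Fock))
    (h : ∀ j, (u : Fock →L[ℂ] Fock) * annihilator j * star (u : Fock →L[ℂ] Fock) ∈ CARAlgebra) :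
    ∀ x ∈ CARAlgebra, (u : Fock →L[ℂ] Fock) * x * star (u : Fock →L[ℂ] Fock) ∈ CARAlgebra := by
  let φ : (Fock →L[ℂ] Fock) →⋆ₐ[ℂ] (Fock →L[ℂ] Fock) :=
    (Unitary.conjStarAlgAut ℂ (Fock →L[ℂ] Fock) u : _ →⋆ₐ[ℂ] _)
  have hφ : Continuous φ := by
    change Continuous fun x => (u : Fock →L[ℂ] Fock) * x * star (u : Fock →L[ℂ] Fock)
    fun_prop
  have hle : CARAlgebra ≤ CARAlgebra.comap φ := by
    refine StarSubalgebra.topologicalClosure_minimal (StarAlgebra.adjoin_le ?_) ?_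
    · rintro _ ⟨j, rfl⟩
      exact h j
    · exact (StarSubalgebra.isClosed_topologicalClosure _).preimage hφ
  exact fun x hx => hle hx

theorem signOp_conj_mem (p : ℤ → Prop) [DecidablePred p] (x : Fock →L[ℂ] Fock)
    (hx : x ∈ CARAlgebra) : signOp p * x * signOp p ∈ CARAlgebra := by
  have := conj_mem_CARAlgebra (signUnitary p) (fun j => by
    rw [coe_signUnitary, star_signOp, signOp_conj_annihilator]
    exact CARAlgebra.smul_mem (annihilator_mem j) _) x hx
  rwa [coe_signUnitary, star_signOp] at this

theorem shiftOp_conj_mem (n : ℤ) (x : Fock →L[ℂ] Fock)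
    (hx : x ∈ CARAlgebra) : shiftOp n * x * shiftOp (-n) ∈ CARAlgebra := by
  have := conj_mem_CARAlgebra (shiftUnitary n) (fun j => by
    rw [coe_shiftUnitary, star_shiftOp, shiftOp_conj_annihilator]
    exact annihilator_mem _) x hx
  rwa [coe_shiftUnitary, star_shiftOp] at this

/-- The annihilation operator `c_j` as an element of the CAR algebra. -/
def c (j : ℤ) : CARAlgebra := ⟨annihilator j, annihilator_mem j⟩

/-- The automorphism of the CAR algebra with `c_j ↦ -c_j` if `p j`, and `c_j ↦ c_j` otherwise. -/
def signAut (p : ℤ → Prop) [DecidablePred p] : CARAlgebra ≃⋆ₐ[ℂ] CARAlgebra :=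
  conjAut CARAlgebra (signUnitary p)
    (fun x hx => by rw [coe_signUnitary, star_signOp]; exact signOp_conj_mem p x hx)
    (fun x hx => by rw [coe_signUnitary, star_signOp]; exact signOp_conj_mem p x hx)

theorem coe_signAut (p : ℤ → Prop) [DecidablePred p] (A : CARAlgebra) :
    (signAut p A : Fock →L[ℂ] Fock) = signOp p * A * signOp p :=
  congrArg (signOp p * (A : Fock →L[ℂ] Fock) * ·) (star_signOp p)

theorem signAut_c (p : ℤ → Prop) [DecidablePred p] (j : ℤ) :
    signAut p (c j) = if p j then -c j else c j := by
  refine Subtype.ext ?_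
  rw [coe_signAut]
  refine (signOp_conj_annihilator p j).trans ?_
  split_ifs <;> simp [c]

/-- The grading `Θ` of the CAR algebra: `Θ(c_j) = -c_j` for all `j`. -/
def grading : CARAlgebra ≃⋆ₐ[ℂ] CARAlgebra := signAut fun _ => True

/-- The automorphism `Θ_-` of the CAR algebra: `Θ_-(c_j) = c_j` for `j ≥ 1` and
`Θ_-(c_j) = -c_j` for `j ≤ 0`. -/
def gradingMinus : CARAlgebra ≃⋆ₐ[ℂ] CARAlgebra := signAut fun i => i ≤ 0

theorem grading_c (j : ℤ) : grading (c j) = -c j := by simp [grading, signAut_c]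

theorem gradingMinus_c (j : ℤ) : gradingMinus (c j) = if j ≤ 0 then -c j else c j :=
  signAut_c _ j

/-- The shift translations of the CAR algebra: `c_j ↦ c_{j+n}`. -/
def carShift (n : ℤ) : CARAlgebra ≃⋆ₐ[ℂ] CARAlgebra :=
  conjAut CARAlgebra (shiftUnitary n)
    (fun x hx => by rw [coe_shiftUnitary, star_shiftOp]; exact shiftOp_conj_mem n x hx)
    (fun x hx => by
      rw [coe_shiftUnitary, star_shiftOp]
      have := shiftOp_conj_mem (-n) x hx
      rwa [neg_neg] at this)

theorem coe_carShift (n : ℤ) (A : CARAlgebra) :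
    (carShift n A : Fock →L[ℂ] Fock) = shiftOp n * A * shiftOp (-n) :=
  congrArg (shiftOp n * (A : Fock →L[ℂ] Fock) * ·) (star_shiftOp n)

theorem carShift_c (n j : ℤ) : carShift n (c j) = c (j + n) := by
  refine Subtype.ext ?_
  rw [coe_carShift]
  exact shiftOp_conj_annihilator n j

theorem gradingMinus_gradingMinus (A : CARAlgebra) : gradingMinus (gradingMinus A) = A := by
  refine Subtype.ext ?_
  have h := signOp_mul_self (fun i => i ≤ 0)
  rw [gradingMinus, coe_signAut, coe_signAut, ← mul_assoc, ← mul_assoc, h, one_mul, mul_assoc, h,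
    mul_one]

theorem grading_grading (A : CARAlgebra) : grading (grading A) = A := by
  refine Subtype.ext ?_
  have h := signOp_mul_self (fun _ => True)
  rw [grading, coe_signAut, coe_signAut, ← mul_assoc, ← mul_assoc, h, one_mul, mul_assoc, h,
    mul_one]

theorem conj_comm {P X A Y : Fock →L[ℂ] Fock} (hX : P * X = X * P) (hY : P * Y = Y * P) :
    P * (X * A * Y) * P = X * (P * A * P) * Y := by
  calc P * (X * A * Y) * P = (P * X) * A * (Y * P) := by simp only [mul_assoc]
    _ = X * (P * A * P) * Y := by rw [hX, ← hY]; simp only [mul_assoc]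

theorem signOp_true_comm_shiftOp (n : ℤ) :
    signOp (fun _ => True) * shiftOp n = shiftOp n * signOp (fun _ => True) := by
  have h := shiftOp_conj_signOp n (fun _ => True)
  calc signOp (fun _ => True) * shiftOp n
      = shiftOp n * signOp (fun _ => True) * shiftOp (-n) * shiftOp n := by rw [h]
    _ = shiftOp n * signOp (fun _ => True) := by
      rw [mul_assoc _ (shiftOp (-n)), shiftOp_mul, neg_add_cancel, shiftOp_zero, mul_one]

theorem grading_gradingMinus (A : CARAlgebra) :
    grading (gradingMinus A) = gradingMinus (grading A) := by
  refine Subtype.ext ?_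
  have h := signOp_comm (fun _ => True) (fun i => i ≤ 0)
  simp only [grading, gradingMinus, coe_signAut]
  exact conj_comm h h

theorem grading_carShift (n : ℤ) (A : CARAlgebra) :
    grading (carShift n A) = carShift n (grading A) := by
  refine Subtype.ext ?_
  simp only [grading, coe_signAut, coe_carShift]
  exact conj_comm (signOp_true_comm_shiftOp n) (signOp_true_comm_shiftOp (-n))

/-- The C*-algebra of `2 × 2` matrices of operators, in which the crossed product of the CAR algebra
by `Θ_-` is realised through its regular representation. -/
abbrev MatOp : Type := CStarMatrix (Fin 2) (Fin 2) (Fock →L[ℂ] Fock)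

/-- The CAR algebra inside the crossed product: `A ↦ diag(A, Θ_-(A))`. -/
def embed : CARAlgebra →⋆ₐ[ℂ] MatOp where
  toFun A := CStarMatrix.ofMatrix !![(A : Fock →L[ℂ] Fock), 0; 0, gradingMinus A]
  map_one' := by ext i j : 1; fin_cases i <;> fin_cases j <;> simp
  map_zero' := by ext i j : 1; fin_cases i <;> fin_cases j <;> simp
  map_mul' A B := by
    ext i j : 1
    fin_cases i <;> fin_cases j <;> simp [CStarMatrix.mul_apply]
  map_add' A B := by ext i j : 1; fin_cases i <;> fin_cases j <;> simp
  map_star' A := by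
    ext i j : 1
    fin_cases i <;> fin_cases j <;> simp [CStarMatrix.star_apply, map_star]
  commutes' a := by
    ext i j : 1
    fin_cases i <;> fin_cases j <;> simp [CStarMatrix.algebraMap_apply, Algebra.algebraMap_eq_smul_one]

/-- The self-adjoint unitary `T` of the crossed product. -/
def T : MatOp := CStarMatrix.ofMatrix !![0, 1; 1, 0]

theorem star_T : star T = T := by
  ext i j : 1; fin_cases i <;> fin_cases j <;> simp [T, CStarMatrix.star_apply]

theorem T_mul_T : T * T = 1 := by
  ext i j : 1
  fin_cases i <;> fin_cases j <;> simp [T, CStarMatrix.mul_apply]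

theorem embed_mul_T (A : CARAlgebra) : embed A * T = T * embed (gradingMinus A) := by
  ext i j : 1
  fin_cases i <;> fin_cases j <;>
    simp [T, embed, CStarMatrix.mul_apply, gradingMinus_gradingMinus]

theorem T_conj_embed (A : CARAlgebra) : T * embed A * T = embed (gradingMinus A) := by
  rw [mul_assoc, embed_mul_T, ← mul_assoc, T_mul_T, one_mul]

/-- The C*-crossed product of the CAR algebra by the `ℤ/2`-action `Θ_-`, generated by the CAR
algebra and `T`. -/
def crossedProduct : StarSubalgebra ℂ MatOp :=
  (StarAlgebra.adjoin ℂ (Set.range embed ∪ {T})).topologicalClosure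

/-- The quantum spin algebra: the sum of the even part of the CAR algebra and `T` times its odd
part, inside the crossed product. -/
def spinAlgebra : StarSubalgebra ℂ MatOp where
  carrier := {x | ∃ A B : CARAlgebra, grading A = A ∧ grading B = -B ∧ x = embed A + T * embed B}
  mul_mem' := by
    rintro _ _ ⟨A, B, hA, hB, rfl⟩ ⟨A', B', hA', hB', rfl⟩
    refine ⟨A * A' + gradingMinus B * B', gradingMinus A * B' + B * A', ?_, ?_, ?_⟩
    · simp [grading_gradingMinus, hA, hB, hA', hB']
    · simp [grading_gradingMinus, hA, hB, hA', hB']; abel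
    · simp only [map_add, map_mul, ← T_conj_embed, mul_add, add_mul]
      have h : T * (T * embed A * T * embed B') = embed A * (T * embed B') := by
        simp only [← mul_assoc, T_mul_T, one_mul]
      rw [h]
      simp only [mul_assoc]; abel
  one_mem' := ⟨1, 0, by simp, by simp, by simp⟩
  add_mem' := by
    rintro _ _ ⟨A, B, hA, hB, rfl⟩ ⟨A', B', hA', hB', rfl⟩
    refine ⟨A + A', B + B', by simp [hA, hA'], by simp [hB, hB']; abel, ?_⟩
    simp [mul_add]; abel
  zero_mem' := ⟨0, 0, by simp, by simp, by simp⟩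
  algebraMap_mem' a := ⟨algebraMap ℂ _ a, 0, AlgHomClass.commutes grading a, by simp, by
    rw [AlgHomClass.commutes embed a]; simp⟩
  star_mem' := by
    rintro _ ⟨A, B, hA, hB, rfl⟩
    refine ⟨star A, gradingMinus (star B), by rw [map_star, hA],
      by rw [grading_gradingMinus, map_star, hB]; simp, ?_⟩
    rw [star_add, star_mul, star_T, map_star, ← embed_mul_T, map_star]

theorem spinAlgebra_le_crossedProduct : spinAlgebra ≤ crossedProduct := by
  rintro _ ⟨A, B, -, -, rfl⟩
  have h : ∀ x ∈ Set.range embed ∪ {T}, x ∈ crossedProduct := fun x hx =>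
    StarSubalgebra.le_topologicalClosure _ (StarAlgebra.subset_adjoin ℂ _ hx)
  exact add_mem (h _ (Or.inl ⟨A, rfl⟩)) (mul_mem (h _ (Or.inr rfl)) (h _ (Or.inl ⟨B, rfl⟩)))

/-- The spin operator `σ^z_j = 2 c_j* c_j - 1`, as an element of the CAR algebra. -/
def sigmaZ (j : ℤ) : CARAlgebra := (2 : ℂ) • (star (c j) * c j) - 1

/-- The string `S^{(j)}`: `σ^z_1 ⋯ σ^z_{j-1}` for `j ≥ 1` (so `1` for `j = 1`), and
`σ^z_0 σ^z_{-1} ⋯ σ^z_j` for `j ≤ 0`. -/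
def jwString (j : ℤ) : CARAlgebra :=
  if 1 ≤ j then ((List.range (j - 1).toNat).map fun k : ℕ => sigmaZ ((k : ℤ) + 1)).prod
  else ((List.range (1 - j).toNat).map fun k : ℕ => sigmaZ (-(k : ℤ))).prod

theorem coe_sigmaZ (j : ℤ) : (sigmaZ j : Fock →L[ℂ] Fock) = -signOp (fun i => i = j) := by
  refine op_ext fun f S => ?_
  have h1 : (sigmaZ j : Fock →L[ℂ] Fock) =
      (2 : ℂ) • (star (annihilator j) * annihilator j) + (-1 : ℂ) • 1 := by
    rw [neg_one_smul, ← sub_eq_add_neg]; rfl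
  have h2 : -signOp (fun i => i = j) = (-1 : ℂ) • signOp (fun i => i = j) := by rw [neg_one_smul]
  rw [h1, h2]
  simp only [add_app, smul_app, mul_app, one_app, star_annihilator_apply, annihilator_apply,
    signOp_apply, mem_flip, countSign_flip, flip_flip]
  have h3 := countSign_mul_self (· < j) S
  by_cases h : j ∈ S
  · have : countSign (fun i => i = j) S = -1 := by
      rw [countSign, Finset.filter_eq', if_pos h]; simp
    simp only [h, this]
    simp
    linear_combination 2 * f S * h3
  · have : countSign (fun i => i = j) S = 1 := by
      rw [countSign, Finset.filter_eq', if_neg h]; simp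
    simp [h, this]

theorem signOp_mul_of_disjoint {p q r : ℤ → Prop} [DecidablePred p] [DecidablePred q]
    [DecidablePred r] (h : ∀ i, r i ↔ p i ∨ q i) (hd : ∀ i, p i → ¬ q i) :
    signOp p * signOp q = signOp r := by
  refine op_ext fun f S => ?_
  rw [mul_app, signOp_apply, signOp_apply, signOp_apply, ← mul_assoc]
  congr 1
  rw [countSign, countSign, countSign, ← pow_add,
    ← Finset.card_union_of_disjoint (Finset.disjoint_filter.2 fun i _ => hd i),
    ← Finset.filter_or]
  congr 2
  ext i; simp [h]

theorem coe_jwString_pos (m : ℕ) :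
    ((((List.range m).map fun k : ℕ => sigmaZ ((k : ℤ) + 1)).prod : CARAlgebra) : Fock →L[ℂ] Fock) =
      (-1 : ℂ) ^ m • (signOp (fun i => i ≤ 0) * signOp (fun i => i ≤ (m : ℤ))) := by
  induction m with
  | zero => simp [signOp_mul_self]
  | succ m ih =>
    have h : signOp (fun i => i ≤ (m : ℤ)) * signOp (fun i => i = (m : ℤ) + 1) =
        signOp (fun i => i ≤ ((m + 1 : ℕ) : ℤ)) :=
      signOp_mul_of_disjoint (by intro i; push_cast; omega) (by intro i; omega)
    rw [List.range_succ, List.map_append, List.prod_append]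
    simp only [List.map_cons, List.map_nil, List.prod_singleton, MulMemClass.coe_mul]
    rw [ih, coe_sigmaZ, pow_succ, smul_mul_assoc, mul_assoc, mul_neg, h]
    simp

theorem coe_jwString_neg (m : ℕ) :
    ((((List.range m).map fun k : ℕ => sigmaZ (-(k : ℤ))).prod : CARAlgebra) : Fock →L[ℂ] Fock) =
      (-1 : ℂ) ^ m • (signOp (fun i => i ≤ 0) * signOp (fun i => i ≤ -(m : ℤ))) := by
  induction m with
  | zero => simp [signOp_mul_self]
  | succ m ih =>
    have h : signOp (fun i => i ≤ -((m + 1 : ℕ) : ℤ)) * signOp (fun i => i = -(m : ℤ)) =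
        signOp (fun i => i ≤ -(m : ℤ)) :=
      signOp_mul_of_disjoint (by intro i; push_cast; omega) (by intro i; push_cast; omega)
    rw [List.range_succ, List.map_append, List.prod_append]
    simp only [List.map_cons, List.map_nil, List.prod_singleton, MulMemClass.coe_mul]
    rw [ih, coe_sigmaZ, pow_succ, smul_mul_assoc, mul_assoc, mul_neg, ← h, mul_assoc,
      signOp_mul_self]
    simp

theorem coe_jwString (n : ℤ) : (jwString (n + 1) : Fock →L[ℂ] Fock) =
    (-1 : ℂ) ^ n • (signOp (fun i => i ≤ 0) * signOp (fun i => i ≤ n)) := by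
  rw [jwString]
  split_ifs with h
  · obtain ⟨m, rfl⟩ := Int.eq_ofNat_of_zero_le (show 0 ≤ n by omega)
    simpa using coe_jwString_pos m
  · obtain ⟨m, hm⟩ := Int.eq_ofNat_of_zero_le (show 0 ≤ -n by omega)
    obtain rfl : n = -(m : ℤ) := by omega
    have h1 : (1 - (-(m : ℤ) + 1)).toNat = m := by omega
    rw [h1, coe_jwString_neg, zpow_neg, zpow_natCast, ← inv_pow]
    norm_num

theorem grading_eq_self_iff (A : CARAlgebra) : grading A = A ↔
    signOp (fun _ => True) * (A : Fock →L[ℂ] Fock) * signOp (fun _ => True) = A := by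
  rw [← Subtype.coe_inj, grading, coe_signAut]

theorem grading_eq_neg_iff (A : CARAlgebra) : grading A = -A ↔
    signOp (fun _ => True) * (A : Fock →L[ℂ] Fock) * signOp (fun _ => True) = -A := by
  rw [← Subtype.coe_inj, grading, coe_signAut]; rfl

theorem grading_jwString (j : ℤ) : grading (jwString j) = jwString j := by
  obtain ⟨n, rfl⟩ : ∃ n, j = n + 1 := ⟨j - 1, by ring⟩
  rw [grading_eq_self_iff, coe_jwString, mul_smul_comm, smul_mul_assoc, ← mul_assoc,
    signOp_comm (fun _ => True), mul_assoc, mul_assoc, signOp_comm (fun i => i ≤ n), ← mul_assoc,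
    ← mul_assoc, mul_assoc (signOp fun i => i ≤ 0), signOp_mul_self, mul_one]

/-- The unitary on Fock space that implements `c_j ↦ (-1)^n c_{j+n}`. -/
def twistedShift (n : ℤ) : unitary (Fock →L[ℂ] Fock) :=
  if Even n then shiftUnitary n else shiftUnitary n * signUnitary (fun _ => True)

theorem twistedShift_conj_even (n : ℤ) {A : CARAlgebra} (hA : grading A = A) :
    (twistedShift n : Fock →L[ℂ] Fock) * A * star (twistedShift n : Fock →L[ℂ] Fock) =
      carShift n A := by
  rw [coe_carShift, twistedShift]
  split_ifs with h
  · rw [coe_shiftUnitary, star_shiftOp]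
  · rw [Submonoid.coe_mul, star_mul, coe_shiftUnitary, coe_signUnitary, star_shiftOp, star_signOp]
    have := (grading_eq_self_iff A).1 hA
    calc _ = shiftOp n * (signOp (fun _ => True) * (A : Fock →L[ℂ] Fock) * signOp (fun _ => True))
          * shiftOp (-n) := by simp only [mul_assoc]
      _ = _ := by rw [this]

theorem twistedShift_conj_odd (n : ℤ) {B : CARAlgebra} (hB : grading B = -B) :
    (twistedShift n : Fock →L[ℂ] Fock) * B * star (twistedShift n : Fock →L[ℂ] Fock) =
      (-1 : ℂ) ^ n • (carShift n B : Fock →L[ℂ] Fock) := by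
  rw [coe_carShift, twistedShift]
  split_ifs with h
  · rw [coe_shiftUnitary, star_shiftOp, h.neg_one_zpow, one_smul]
  · rw [Submonoid.coe_mul, star_mul, coe_shiftUnitary, coe_signUnitary, star_shiftOp, star_signOp,
      (Int.not_even_iff_odd.1 h).neg_one_zpow]
    have := (grading_eq_neg_iff B).1 hB
    calc _ = shiftOp n * (signOp (fun _ => True) * (B : Fock →L[ℂ] Fock) * signOp (fun _ => True))
          * shiftOp (-n) := by simp only [mul_assoc]
      _ = _ := by rw [this]; simp

theorem twistedShift_conj_signOp (n : ℤ) :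
    (twistedShift n : Fock →L[ℂ] Fock) * signOp (fun i => i ≤ 0) *
      star (twistedShift n : Fock →L[ℂ] Fock) = signOp (fun i => i ≤ n) := by
  have h0 : shiftOp n * signOp (fun i => i ≤ 0) * shiftOp (-n) = signOp (fun i => i ≤ n) := by
    rw [shiftOp_conj_signOp]; congr 1; ext i; simp
  rw [twistedShift]
  split_ifs with h
  · rw [coe_shiftUnitary, star_shiftOp, h0]
  · rw [Submonoid.coe_mul, star_mul, coe_shiftUnitary, coe_signUnitary, star_shiftOp, star_signOp,
      ← h0]
    calc _ = shiftOp n * (signOp (fun _ => True) * signOp (fun i => i ≤ 0)) * signOp (fun _ => True)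
          * shiftOp (-n) := by simp only [mul_assoc]
      _ = shiftOp n * signOp (fun i => i ≤ 0) * (signOp (fun _ => True) * signOp (fun _ => True))
          * shiftOp (-n) := by rw [signOp_comm]; simp only [mul_assoc]
      _ = _ := by rw [signOp_mul_self, mul_one]

theorem star_twistedShift (n : ℤ) :
    star (twistedShift n : Fock →L[ℂ] Fock) = twistedShift (-n) := by
  rw [twistedShift, twistedShift]
  simp only [even_neg]
  split_ifs with h
  · exact star_shiftOp n
  · rw [Submonoid.coe_mul, Submonoid.coe_mul, star_mul, coe_shiftUnitary, coe_signUnitary,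
      coe_shiftUnitary, star_shiftOp, star_signOp, signOp_true_comm_shiftOp]

/-- The unitary matrix `diag(W, P W P)`, where `W` is the twisted shift and `P` implements `Θ_-`. -/
def spinShiftUnitary (n : ℤ) : unitary MatOp :=
  ⟨CStarMatrix.ofMatrix !![(twistedShift n : Fock →L[ℂ] Fock), 0;
      0, signOp (fun i => i ≤ 0) * twistedShift n * signOp (fun i => i ≤ 0)], by
    have h1 : star (twistedShift n : Fock →L[ℂ] Fock) * twistedShift n = 1 :=
      Unitary.coe_star_mul_self _
    have h2 : (twistedShift n : Fock →L[ℂ] Fock) * star (twistedShift n : Fock →L[ℂ] Fock) = 1 :=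
      Unitary.coe_mul_star_self _
    have h3 := signOp_mul_self (fun i => i ≤ 0)
    have h3' : ∀ x, signOp (fun i => i ≤ 0) * (signOp (fun i => i ≤ 0) * x) = x := fun x => by
      rw [← mul_assoc, h3, one_mul]
    have h1' : ∀ x, star (twistedShift n : Fock →L[ℂ] Fock) * (twistedShift n * x) = x :=
      fun x => by rw [← mul_assoc, h1, one_mul]
    have h2' : ∀ x, (twistedShift n : Fock →L[ℂ] Fock) *
        (star (twistedShift n : Fock →L[ℂ] Fock) * x) = x :=
      fun x => by rw [← mul_assoc, h2, one_mul]
    rw [Unitary.mem_iff]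
    constructor
    · ext i j : 1
      fin_cases i <;> fin_cases j <;> simp [CStarMatrix.mul_apply, CStarMatrix.star_apply,
        star_signOp, mul_assoc, h1, h1', h3, h3', -Unitary.coe_star]
    · ext i j : 1
      fin_cases i <;> fin_cases j <;> simp [CStarMatrix.mul_apply, CStarMatrix.star_apply,
        star_signOp, mul_assoc, h2, h2', h3, h3', -Unitary.coe_star]⟩

theorem star_spinShiftUnitary (n : ℤ) :
    star (spinShiftUnitary n : MatOp) = spinShiftUnitary (-n) := by
  ext i j : 1
  fin_cases i <;> fin_cases j <;> simp [spinShiftUnitary, CStarMatrix.star_apply,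
    star_signOp, star_twistedShift, mul_assoc, -Unitary.coe_star]

theorem spinShiftUnitary_conj (n : ℤ) {A B : CARAlgebra} (hA : grading A = A)
    (hB : grading B = -B) :
    (spinShiftUnitary n : MatOp) * (embed A + T * embed B) * star (spinShiftUnitary n : MatOp) =
      embed (carShift n A) + T * embed (jwString (n + 1) * carShift n B) := by
  have h3 : ∀ x, signOp (fun i => i ≤ 0) * (signOp (fun i => i ≤ 0) * x) = x := fun x => by
    rw [← mul_assoc, signOp_mul_self, one_mul]
  have hW : ∀ x, star (twistedShift n : Fock →L[ℂ] Fock) * (twistedShift n * x) = x := fun x => by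
    have : star (twistedShift n : Fock →L[ℂ] Fock) * twistedShift n = 1 :=
      Unitary.coe_star_mul_self _
    rw [← mul_assoc, this, one_mul]
  have hA' := twistedShift_conj_even n hA
  have hJ : ((jwString (n + 1) * carShift n B : CARAlgebra) : Fock →L[ℂ] Fock) =
      signOp (fun i => i ≤ 0) * twistedShift n * signOp (fun i => i ≤ 0) * B *
        star (twistedShift n : Fock →L[ℂ] Fock) := by
    rw [MulMemClass.coe_mul, coe_jwString, smul_mul_assoc, ← mul_smul_comm,
      ← twistedShift_conj_odd n hB, ← twistedShift_conj_signOp n]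
    simp only [mul_assoc, hW]
  ext i j : 1
  fin_cases i <;> fin_cases j
  · simp [spinShiftUnitary, embed, T, CStarMatrix.mul_apply, CStarMatrix.star_apply, hA',
      -Unitary.coe_star]
  · simp [spinShiftUnitary, embed, T, CStarMatrix.mul_apply, CStarMatrix.star_apply,
      -Unitary.coe_star, -MulMemClass.coe_mul, -map_mul]
    rw [gradingMinus, coe_signAut, coe_signAut, hJ, star_signOp]
    simp only [mul_assoc, h3]
  · simp [spinShiftUnitary, embed, T, CStarMatrix.mul_apply, CStarMatrix.star_apply,
      -Unitary.coe_star, -MulMemClass.coe_mul, -map_mul]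
    rw [hJ]
  · simp [spinShiftUnitary, embed, T, CStarMatrix.mul_apply, CStarMatrix.star_apply,
      -Unitary.coe_star, -MulMemClass.coe_mul, -map_mul]
    rw [gradingMinus, coe_signAut, coe_signAut, ← hA', star_signOp]
    simp only [mul_assoc, h3]

theorem spinShiftUnitary_conj_mem (n : ℤ) (x : MatOp) (hx : x ∈ spinAlgebra) :
    (spinShiftUnitary n : MatOp) * x * star (spinShiftUnitary n : MatOp) ∈ spinAlgebra := by
  obtain ⟨A, B, hA, hB, rfl⟩ := hx
  refine ⟨_, _, ?_, ?_, spinShiftUnitary_conj n hA hB⟩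
  · rw [grading_carShift, hA]
  · rw [map_mul, grading_jwString, grading_carShift, hB, map_neg, mul_neg]

/-- The shift translations of the spin algebra: `σ^a_j ↦ σ^a_{j+n}` for `a = x, y, z`
(`spinShift_pauliX`, `spinShift_pauliY`, `spinShift_pauliZ`). -/
def spinShift (n : ℤ) : spinAlgebra ≃⋆ₐ[ℂ] spinAlgebra :=
  conjAut spinAlgebra (spinShiftUnitary n) (spinShiftUnitary_conj_mem n) (fun x hx => by
    have := spinShiftUnitary_conj_mem (-n) x hx
    rwa [← star_spinShiftUnitary, star_star] at this)

theorem coe_spinShift (n : ℤ) (x : spinAlgebra) : (spinShift n x : MatOp) =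
    (spinShiftUnitary n : MatOp) * x * star (spinShiftUnitary n : MatOp) := rfl

theorem grading_sigmaZ (j : ℤ) : grading (sigmaZ j) = sigmaZ j := by
  simp [sigmaZ, map_star, grading_c]

/-- The Pauli matrix `σ^z_j`. -/
def pauliZ (j : ℤ) : spinAlgebra :=
  ⟨embed (sigmaZ j), sigmaZ j, 0, grading_sigmaZ j, by simp, by simp⟩

/-- The Pauli matrix `σ^x_j = T S^{(j)} (c_j + c_j*)`. -/
def pauliX (j : ℤ) : spinAlgebra :=
  ⟨T * embed (jwString j * (c j + star (c j))), 0, jwString j * (c j + star (c j)), by simp, by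
    rw [map_mul, grading_jwString, map_add, map_star, grading_c, star_neg, ← neg_add, mul_neg],
    by simp⟩

/-- The Pauli matrix `σ^y_j = i T S^{(j)} (c_j - c_j*)`. -/
def pauliY (j : ℤ) : spinAlgebra :=
  Complex.I • ⟨T * embed (jwString j * (c j - star (c j))), 0, jwString j * (c j - star (c j)),
    by simp, by
      rw [map_mul, grading_jwString, map_sub, map_star, grading_c, star_neg, ← mul_neg]
      congr 1; abel,
    by simp⟩

theorem spinShift_pauliZ (n j : ℤ) : spinShift n (pauliZ j) = pauliZ (j + n) := by
  refine Subtype.ext ?_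
  have h := spinShiftUnitary_conj n (grading_sigmaZ j) (B := 0) (by simp)
  simp only [map_zero, mul_zero, add_zero] at h
  rw [coe_spinShift]
  refine h.trans ?_
  simp [pauliZ, sigmaZ, map_star, carShift_c]

theorem jwString_mul_carShift (n j : ℤ) :
    jwString (n + 1) * carShift n (jwString j) = jwString (j + n) := by
  obtain ⟨k, rfl⟩ : ∃ k, j = k + 1 := ⟨j - 1, by ring⟩
  refine Subtype.ext ?_
  have hp : ∀ m : ℤ, shiftOp n * signOp (fun i => i ≤ m) * shiftOp (-n) =
      signOp (fun i => i ≤ m + n) := by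
    intro m
    rw [shiftOp_conj_signOp]; congr 1; ext i; simp
  have h1 : shiftOp n * (signOp (fun i => i ≤ 0) * signOp (fun i => i ≤ k)) * shiftOp (-n) =
      signOp (fun i => i ≤ n) * signOp (fun i => i ≤ k + n) := by
    have h0 := hp 0
    simp only [zero_add] at h0
    rw [← hp k, ← h0]
    calc _ = shiftOp n * signOp (fun i => i ≤ 0) * 1 * signOp (fun i => i ≤ k) * shiftOp (-n) := by
          simp only [mul_assoc, one_mul]
      _ = _ := by
          rw [← shiftOp_zero, ← neg_add_cancel n, ← shiftOp_mul]; simp only [mul_assoc]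
  have h2 : k + 1 + n = (k + n) + 1 := by ring
  rw [MulMemClass.coe_mul, coe_carShift, h2, coe_jwString, coe_jwString, coe_jwString,
    mul_smul_comm, smul_mul_assoc ((-1 : ℂ) ^ k), h1, smul_mul_smul_comm, mul_assoc, ← mul_assoc (signOp _)
    (signOp fun i => i ≤ n) (signOp fun i => i ≤ k + n), signOp_mul_self, one_mul,
    ← zpow_add₀ (by norm_num), add_comm n k]

theorem spinShift_pauliX (n j : ℤ) : spinShift n (pauliX j) = pauliX (j + n) := by
  refine Subtype.ext ?_
  have h := spinShiftUnitary_conj n (A := 0) (by simp) (B := jwString j * (c j + star (c j))) (by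
    rw [map_mul, grading_jwString, map_add, map_star, grading_c, star_neg, ← neg_add, mul_neg])
  rw [map_zero, map_zero, map_zero, zero_add, zero_add, map_mul (carShift n), ← mul_assoc (jwString (n + 1)),
    jwString_mul_carShift, map_add, map_star, carShift_c] at h
  exact h

theorem spinShift_pauliY (n j : ℤ) : spinShift n (pauliY j) = pauliY (j + n) := by
  rw [pauliY, pauliY, map_smul]
  congr 1
  refine Subtype.ext ?_
  have h := spinShiftUnitary_conj n (A := 0) (by simp) (B := jwString j * (c j - star (c j))) (by
    rw [map_mul, grading_jwString, map_sub, map_star, grading_c, star_neg, ← mul_neg]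
    congr 1; abel)
  rw [map_zero, map_zero, map_zero, zero_add, zero_add, map_mul (carShift n), ← mul_assoc (jwString (n + 1)),
    jwString_mul_carShift, map_sub, map_star, carShift_c] at h
  exact h

/-- A C*-flow: a strongly continuous one-parameter group of star automorphisms. -/
structure CStarFlow (A : Type*) [NormedRing A] [StarRing A] [NormedAlgebra ℂ A] where
  /-- The automorphism at time `t`. -/
  aut : ℝ → (A ≃⋆ₐ[ℂ] A)
  aut_zero : ∀ a, aut 0 a = a
  aut_add : ∀ s t a, aut (s + t) a = aut s (aut t a)
  continuous_aut : ∀ a, Continuous fun t => aut t a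

/-- The filter of neighbourhoods of infinity `|t| → ∞` in `ℝ`. -/
def absAtTop : Filter ℝ := Filter.comap (fun t => |t|) Filter.atTop

/-- The norm asymptotically abelian condition. -/
def CStarFlow.AsymptoticallyAbelian {A : Type*} [NormedRing A] [StarRing A] [NormedAlgebra ℂ A]
    (α : CStarFlow A) : Prop :=
  ∀ a b : A, Filter.Tendsto (fun t => ‖a * α.aut t b - α.aut t b * a‖) absAtTop (nhds 0)

/-- The even part `(A + Θ(A)) / 2`. -/
def evenPart (A : CARAlgebra) : CARAlgebra := (1 / 2 : ℂ) • (A + grading A)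

/-- The odd part `(A - Θ(A)) / 2`. -/
def oddPart (A : CARAlgebra) : CARAlgebra := (1 / 2 : ℂ) • (A - grading A)

/-- The graded commutator: the bilinear map that is the commutator unless both arguments are odd,
and the anticommutator if both are odd. -/
def gradedCommutator (A B : CARAlgebra) : CARAlgebra :=
  (evenPart A * B - B * evenPart A) + (oddPart A * evenPart B - evenPart B * oddPart A) +
    (oddPart A * oddPart B + oddPart B * oddPart A)

/-- The norm `Θ`-graded asymptotically abelian condition. -/
def GradedAsymptoticallyAbelian (α : CStarFlow CARAlgebra) : Prop :=
  ∀ A B : CARAlgebra,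
    Filter.Tendsto (fun t => ‖gradedCommutator A (α.aut t B)‖) absAtTop (nhds 0)

end QuantumChain

end

noncomputable section

namespace QuantumChain

open Filter Topology

/-! Integer times suffice. Write `t = ⌊t⌋ + fract t`: the flow acts as an integer shift on `α_{fract
t}(B)`, which runs through the compact set `{α_s(B) : 0 ≤ s ≤ 1}`. Since shifts are isometric, the
(graded) commutators with shifted elements are Lipschitz uniformly in `n`, so pointwise convergence
along the integers is uniform on this compact set (`tendsto_floor_fract`).

At integer times everything rests on `tendsto_intertwine`: for isometric `φ_n`, `ψ_n` and bounded
`X_n`, the elements `A` with `φ_n(A) X_n - X_n ψ_n(A) → 0` form a closed subalgebra, so the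
generators `c_j`, `c_j*` need checking only. For the CAR algebra it is used twice, once in the
shifted variable and once in the fixed one, starting from the anticommutation relations.

For the spin algebra, the shift sends `A' + T B'` to `τ_n A' + T S τ_n B'`, where `S = S^{(n+1)}`.
Let `Θ_{≤m}` change the sign of the `c_j` with `j ≤ m`. Moving `S` and `T` to the left in the
commutator (`commutator_spin`) replaces some factors by `Θ_{≤n}` of `A` or `B`, or by `Θ_{≤-n}` of
`A'` or `B'`. As `n → +∞` these automorphisms tend pointwise to `Θ` and to the identity; as `n → -∞`
the roles are exchanged. In both cases exactly one of the odd elements `B`, `B'` changes sign, which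
turns the odd-odd commutator into an anticommutator, and that vanishes in the limit by the CAR
result. -/

theorem isClosed_CARAlgebra : IsClosed (CARAlgebra : Set (Fock →L[ℂ] Fock)) :=
  StarSubalgebra.isClosed_topologicalClosure _

/-! ### From integer times to real times -/

/-- Equicontinuous functions that tend to zero pointwise along the integers do so uniformly on the
compact set `γ '' [0, 1]`, hence along `t ↦ (⌊t⌋, γ (fract t))`. -/
theorem tendsto_floor_fract {X : Type*} [NormedAddCommGroup X] (F : ℤ → X → ℝ) (M : ℝ)
    (hF : ∀ n x y, F n x ≤ F n y + M * ‖x - y‖) (hF0 : ∀ n x, 0 ≤ F n x)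
    (hlim : ∀ x, Tendsto (fun n => F n x) cofinite (𝓝 0)) (γ : ℝ → X) (hγ : Continuous γ) :
    Tendsto (fun t : ℝ => F ⌊t⌋ (γ (Int.fract t))) absAtTop (𝓝 0) := by
  -- Both filters are the supremum of `atBot` and `atTop`, on `ℝ` and on `ℤ`.
  have hfloor : Tendsto (fun t : ℝ => ⌊t⌋) absAtTop cofinite := by
    rw [absAtTop, comap_abs_atTop, Int.cofinite_eq]
    exact tendsto_floor_atBot.sup_sup tendsto_floor_atTop
  refine Metric.tendsto_nhds.2 fun ε hε => ?_
  -- The sign of `M` is not known; `|M| + 1` is a positive upper bound that one can divide by.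
  have hM : 0 < |M| + 1 := by positivity
  have hδ : 0 < ε / 2 / (|M| + 1) := by positivity
  obtain ⟨s, hs, hcov⟩ := Metric.totallyBounded_iff.1
    ((isCompact_Icc (a := (0 : ℝ)) (b := 1)).image hγ).totallyBounded _ hδ
  -- The net `s` is finite, so one cofinite set of `n` serves all its points.
  have hev : ∀ᶠ n : ℤ in cofinite, ∀ y ∈ s, F n y < ε / 2 :=
    (eventually_all_finite hs).2 fun y _ => (hlim y).eventually_lt_const (by positivity)
  filter_upwards [hfloor.eventually hev] with t ht
  have hmem : γ (Int.fract t) ∈ γ '' Set.Icc 0 1 :=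
    ⟨_, ⟨Int.fract_nonneg t, (Int.fract_lt_one t).le⟩, rfl⟩
  obtain ⟨y, hy, hxy⟩ := Set.mem_iUnion₂.1 (hcov hmem)
  rw [Metric.mem_ball, dist_eq_norm, lt_div_iff₀ hM] at hxy
  rw [Real.dist_eq, sub_zero, abs_of_nonneg (hF0 _ _)]
  have h1 := hF ⌊t⌋ (γ (Int.fract t)) y
  have h2 := ht y hy
  have h3 : M * ‖γ (Int.fract t) - y‖ ≤ ‖γ (Int.fract t) - y‖ * (|M| + 1) := by
    nlinarith [le_abs_self M, norm_nonneg (γ (Int.fract t) - y)]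
  linarith

/-! ### Asymptotic intertwining relations -/

/-- Injective star homomorphisms of C*-algebras are isometric; closedness of the subalgebra is what
makes it a C*-algebra here. -/
theorem norm_aut (φ : CARAlgebra ≃⋆ₐ[ℂ] CARAlgebra) (A : CARAlgebra) : ‖φ A‖ = ‖A‖ :=
  have := isClosed_CARAlgebra
  NonUnitalStarAlgHom.norm_map φ φ.injective A

/-- A Leibniz rule: the defect at `a * b` is `φ_n(a)` times the defect at `b` plus the defect at `a`
times `ψ_n(b)`, and the outer factors have norms independent of `n`. -/
theorem tendsto_intertwine_mul {l : Filter ℤ} (φ ψ : ℤ → CARAlgebra ≃⋆ₐ[ℂ] CARAlgebra)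
    (X : ℤ → CARAlgebra) {a b : CARAlgebra}
    (ha : Tendsto (fun n => φ n a * X n - X n * ψ n a) l (𝓝 0))
    (hb : Tendsto (fun n => φ n b * X n - X n * ψ n b) l (𝓝 0)) :
    Tendsto (fun n => φ n (a * b) * X n - X n * ψ n (a * b)) l (𝓝 0) := by
  have := (hb.norm.const_mul ‖a‖).add (ha.norm.mul_const ‖b‖)
  simp only [norm_zero, mul_zero, zero_mul, add_zero] at this
  refine squeeze_zero_norm (fun n => ?_) this
  have e : φ n (a * b) * X n - X n * ψ n (a * b) =
      φ n a * (φ n b * X n - X n * ψ n b) + (φ n a * X n - X n * ψ n a) * ψ n b := by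
    rw [map_mul, map_mul]; noncomm_ring
  rw [e]
  refine (norm_add_le _ _).trans (add_le_add ?_ ?_)
  · exact (norm_mul_le _ _).trans_eq (by rw [norm_aut])
  · exact (norm_mul_le _ _).trans_eq (by rw [norm_aut])

/-- The intertwining condition is not stable under adjoints, because `X_n` need not be self-adjoint.
The induction therefore runs over the plain algebra generated by the `c_j` and the `c_j*`, and both
kinds of generators need a hypothesis. -/
theorem tendsto_intertwine_adjoin {l : Filter ℤ} (φ ψ : ℤ → CARAlgebra ≃⋆ₐ[ℂ] CARAlgebra)
    (X : ℤ → CARAlgebra)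
    (h : ∀ j, Tendsto (fun n => φ n (c j) * X n - X n * ψ n (c j)) l (𝓝 0))
    (h' : ∀ j, Tendsto (fun n => φ n (star (c j)) * X n - X n * ψ n (star (c j))) l (𝓝 0))
    {x : Fock →L[ℂ] Fock} (hxs : x ∈ StarAlgebra.adjoin ℂ (Set.range annihilator)) :
    ∀ hx : x ∈ CARAlgebra,
      Tendsto (fun n => φ n ⟨x, hx⟩ * X n - X n * ψ n ⟨x, hx⟩) l (𝓝 0) := by
  rw [← StarSubalgebra.mem_toSubalgebra, StarAlgebra.adjoin_toSubalgebra] at hxs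
  have hle : ∀ y ∈ Algebra.adjoin ℂ (Set.range annihilator ∪ star (Set.range annihilator)),
      y ∈ CARAlgebra := by
    intro y hy
    rw [← StarAlgebra.adjoin_toSubalgebra] at hy
    exact StarSubalgebra.le_topologicalClosure _ hy
  induction hxs using Algebra.adjoin_induction with
  | mem x hx =>
    intro hxm
    rcases hx with ⟨j, rfl⟩ | ⟨j, hj⟩
    · exact h j
    · obtain rfl : x = star (annihilator j) := by rw [hj, star_star]
      exact h' j
  | algebraMap r =>
    intro hxm
    have hr : (⟨algebraMap ℂ _ r, hxm⟩ : CARAlgebra) = algebraMap ℂ CARAlgebra r := rfl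
    simp only [hr]
    refine tendsto_const_nhds.congr fun n => ?_
    have h1 : φ n (algebraMap ℂ CARAlgebra r) = algebraMap ℂ CARAlgebra r :=
      AlgHomClass.commutes _ _
    have h2 : ψ n (algebraMap ℂ CARAlgebra r) = algebraMap ℂ CARAlgebra r :=
      AlgHomClass.commutes _ _
    rw [h1, h2, Algebra.commutes, sub_self]
  | add x y hx hy ihx ihy =>
    intro hxm
    have hr : (⟨x + y, hxm⟩ : CARAlgebra) = ⟨x, hle x hx⟩ + ⟨y, hle y hy⟩ := rfl
    have := (ihx (hle x hx)).add (ihy (hle y hy))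
    rw [add_zero] at this
    refine this.congr fun n => ?_
    rw [hr, map_add, map_add]
    noncomm_ring
  | mul x y hx hy ihx ihy =>
    intro hxm
    have hr : (⟨x * y, hxm⟩ : CARAlgebra) = ⟨x, hle x hx⟩ * ⟨y, hle y hy⟩ := rfl
    rw [hr]
    exact tendsto_intertwine_mul φ ψ X (ihx (hle x hx)) (ihy (hle y hy))

/-- The defect is linear in its argument with operator norm at most `2 * M`, whatever the
automorphisms are. This uniformity carries convergence from a dense set to its closure. -/
theorem norm_intertwine_le (φ ψ : CARAlgebra ≃⋆ₐ[ℂ] CARAlgebra) {X : CARAlgebra} {M : ℝ}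
    (hX : ‖X‖ ≤ M) (A B : CARAlgebra) :
    ‖φ A * X - X * ψ A‖ ≤ ‖φ B * X - X * ψ B‖ + 2 * M * ‖A - B‖ := by
  have e : φ A * X - X * ψ A =
      (φ B * X - X * ψ B) + (φ (A - B) * X - X * ψ (A - B)) := by
    rw [map_sub, map_sub]; noncomm_ring
  have h1 : ‖φ (A - B) * X‖ ≤ ‖A - B‖ * M :=
    (norm_mul_le _ _).trans (by rw [norm_aut]; gcongr)
  have h2 : ‖X * ψ (A - B)‖ ≤ M * ‖A - B‖ :=
    (norm_mul_le _ _).trans (by rw [norm_aut]; gcongr)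
  have h3 := norm_sub_le (φ (A - B) * X) (X * ψ (A - B))
  have h4 := norm_add_le (φ B * X - X * ψ B) (φ (A - B) * X - X * ψ (A - B))
  rw [← e] at h4
  linarith

theorem exists_adjoin_norm_sub_lt (A : CARAlgebra) {δ : ℝ} (hδ : 0 < δ) :
    ∃ B : CARAlgebra, (B : Fock →L[ℂ] Fock) ∈ StarAlgebra.adjoin ℂ (Set.range annihilator) ∧
      ‖A - B‖ < δ := by
  obtain ⟨x, hx, hxA⟩ := Metric.mem_closure_iff.1
    (show (A : Fock →L[ℂ] Fock) ∈ closure (StarAlgebra.adjoin ℂ (Set.range annihilator) :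
      Set (Fock →L[ℂ] Fock)) from A.2) _ hδ
  refine ⟨⟨x, StarSubalgebra.le_topologicalClosure _ hx⟩, hx, ?_⟩
  rw [dist_eq_norm] at hxA
  exact hxA

/-- If a bounded family `X` asymptotically intertwines two families of automorphisms on the
generators, then it does so on the whole CAR algebra. -/
theorem tendsto_intertwine {l : Filter ℤ} (φ ψ : ℤ → CARAlgebra ≃⋆ₐ[ℂ] CARAlgebra)
    (X : ℤ → CARAlgebra) (M : ℝ) (hX : ∀ n, ‖X n‖ ≤ M)
    (h : ∀ j, Tendsto (fun n => φ n (c j) * X n - X n * ψ n (c j)) l (𝓝 0))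
    (h' : ∀ j, Tendsto (fun n => φ n (star (c j)) * X n - X n * ψ n (star (c j))) l (𝓝 0))
    (A : CARAlgebra) : Tendsto (fun n => φ n A * X n - X n * ψ n A) l (𝓝 0) := by
  have hM : 0 ≤ M := (norm_nonneg _).trans (hX 0)
  refine Metric.tendsto_nhds.2 fun ε hε => ?_
  -- The summand `1` keeps the divisor positive when `M = 0`.
  have hδ : 0 < ε / 2 / (2 * M + 1) := by positivity
  obtain ⟨B, hB, hd⟩ := exists_adjoin_norm_sub_lt A hδ
  have hB0 := tendsto_intertwine_adjoin φ ψ X h h' hB B.2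
  rw [lt_div_iff₀ (by positivity)] at hd
  filter_upwards [Metric.tendsto_nhds.1 hB0 (ε / 2) (by positivity)] with n hn
  rw [dist_zero_right] at hn ⊢
  have h1 := norm_intertwine_le (φ n) (ψ n) (hX n) A B
  have h2 := norm_nonneg (A - B)
  change ‖φ n B * X n - X n * ψ n B‖ < ε / 2 at hn
  linarith

/-! ### Asymptotic graded commutation under integer shifts of the CAR algebra -/

theorem c_anticomm (i j : ℤ) : c i * c j + c j * c i = 0 :=
  Subtype.ext (annihilator_anticomm i j)

theorem star_c_anticomm {i j : ℤ} (h : i ≠ j) : star (c i) * c j + c j * star (c i) = 0 :=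
  Subtype.ext ((star_annihilator_anticomm i j).trans (by rw [if_neg h]; rfl))

theorem eventually_ne_add (i j : ℤ) : ∀ᶠ n : ℤ in cofinite, i + n ≠ j := by
  filter_upwards [(Set.finite_singleton (j - i)).compl_mem_cofinite] with n hn h
  exact hn (by simp; omega)

/-- A generator asymptotically graded-commutes with the translates of every element. -/
theorem tendsto_carShift_c (j : ℤ) (B : CARAlgebra) :
    Tendsto (fun n => carShift n (grading B) * c j - c j * carShift n B) cofinite (𝓝 0) := by
  -- Here the shifted element is the variable and `c j` is the intertwiner. The grading supplies the
  -- sign that turns anticommutators of generators into intertwining defects.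
  refine tendsto_intertwine (fun n => grading.trans (carShift n)) carShift (fun _ => c j) ‖c j‖
    (fun _ => le_rfl) (fun i => ?_) (fun i => ?_) B
  · refine tendsto_const_nhds.congr fun n => ?_
    change 0 = carShift n (grading (c i)) * c j - c j * carShift n (c i)
    rw [grading_c, map_neg, carShift_c, neg_mul, ← neg_add', c_anticomm, neg_zero]
  -- The defect vanishes unless `i + n = j`, hence for all but one `n`; for `c i` above it vanishes
  -- for every `n`.
  · refine tendsto_const_nhds.congr' ?_
    filter_upwards [eventually_ne_add i j] with n hn
    change 0 = carShift n (grading (star (c i))) * c j - c j * carShift n (star (c i))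
    rw [map_star, map_star, map_star, grading_c, map_neg, star_neg, carShift_c, neg_mul, ← neg_add',
      star_c_anticomm hn, neg_zero]

/-- The adjoint of the relation for `c j`, taken at `Θ(B*)` so that the two gradings land in the
right places. -/
theorem tendsto_carShift_star_c (j : ℤ) (B : CARAlgebra) :
    Tendsto (fun n => carShift n (grading B) * star (c j) - star (c j) * carShift n B)
      cofinite (𝓝 0) := by
  have h := (tendsto_carShift_c j (grading (star B))).star
  replace h := h.neg
  rw [star_zero, neg_zero] at h
  refine h.congr fun n => ?_
  simp [map_star, grading_grading]

/-- The roles are exchanged: the translates of `B`, bounded by `‖B‖`, are now the intertwiners and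
`A` is the variable. The generator case is the preceding pair of lemmas, where evenness of `B`
removes the grading. -/
theorem tendsto_comm_even (A : CARAlgebra) {B : CARAlgebra} (hB : grading B = B) :
    Tendsto (fun n => A * carShift n B - carShift n B * A) cofinite (𝓝 0) := by
  refine tendsto_intertwine (fun _ => .refl ℂ CARAlgebra) (fun _ => .refl ℂ CARAlgebra) (fun n => carShift n B) ‖B‖
    (fun n => (norm_aut _ _).le) (fun j => ?_) (fun j => ?_) A
  · have h := (tendsto_carShift_c j B).neg
    simpa [hB] using h
  · have h := (tendsto_carShift_star_c j B).neg
    simpa [hB] using h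

/-- The same exchange of roles, now intertwining the identity with `Θ`. This one statement contains
the commutator for even `A` and the anticommutator for odd `A`. -/
theorem tendsto_comm_odd (A : CARAlgebra) {B : CARAlgebra} (hB : grading B = -B) :
    Tendsto (fun n => A * carShift n B - carShift n B * grading A) cofinite (𝓝 0) := by
  refine tendsto_intertwine (fun _ => .refl ℂ CARAlgebra) (fun _ => grading) (fun n => carShift n B) ‖B‖
    (fun n => (norm_aut _ _).le) (fun j => ?_) (fun j => ?_) A
  · have h := (tendsto_carShift_c j B).neg
    simpa [hB, grading_c, add_comm] using h
  · have h := (tendsto_carShift_star_c j B).neg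
    simpa [hB, grading_c, map_star, add_comm] using h

/-- Splitting only the second argument is enough, since `Θ` carries the sign of the first; the two
summands are those of `tendsto_comm_even` and `tendsto_comm_odd`. -/
theorem gradedCommutator_eq (A B : CARAlgebra) : gradedCommutator A B =
    (A * evenPart B - evenPart B * A) + (A * oddPart B - oddPart B * grading A) := by
  have hA : A = evenPart A + oddPart A := by
    simp only [evenPart, oddPart]; module
  have hA' : grading A = evenPart A - oddPart A := by
    simp only [evenPart, oddPart]; module
  have hB : B = evenPart B + oddPart B := by
    simp only [evenPart, oddPart]; module
  rw [gradedCommutator]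
  rw [hA']
  generalize evenPart A = a at *
  generalize oddPart A = a' at *
  generalize evenPart B = b at *
  generalize oddPart B = b' at *
  subst hA hB
  noncomm_ring

theorem grading_evenPart (A : CARAlgebra) : grading (evenPart A) = evenPart A := by
  rw [evenPart, map_smul, map_add, grading_grading, add_comm]

theorem grading_oddPart (A : CARAlgebra) : grading (oddPart A) = -oddPart A := by
  rw [oddPart, map_smul, map_sub, grading_grading, ← smul_neg, neg_sub]

theorem evenPart_carShift (n : ℤ) (A : CARAlgebra) :
    evenPart (carShift n A) = carShift n (evenPart A) := by
  simp [evenPart, grading_carShift]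

theorem oddPart_carShift (n : ℤ) (A : CARAlgebra) :
    oddPart (carShift n A) = carShift n (oddPart A) := by
  simp [oddPart, grading_carShift]

theorem tendsto_gradedCommutator (A B : CARAlgebra) :
    Tendsto (fun n => ‖gradedCommutator A (carShift n B)‖) cofinite (𝓝 0) := by
  have h := ((tendsto_comm_even A (grading_evenPart B)).add
    (tendsto_comm_odd A (grading_oddPart B))).norm
  rw [add_zero, norm_zero] at h
  simpa only [gradedCommutator_eq, evenPart_carShift, oddPart_carShift] using h

theorem norm_evenPart_le (A : CARAlgebra) : ‖evenPart A‖ ≤ ‖A‖ := by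
  have := norm_add_le A (grading A)
  rw [norm_aut] at this
  have h2 : ‖(1 / 2 : ℂ)‖ = 1 / 2 := by norm_num
  rw [evenPart, norm_smul, h2]
  linarith

theorem norm_oddPart_le (A : CARAlgebra) : ‖oddPart A‖ ≤ ‖A‖ := by
  have := norm_sub_le A (grading A)
  rw [norm_aut] at this
  have h2 : ‖(1 / 2 : ℂ)‖ = 1 / 2 := by norm_num
  rw [oddPart, norm_smul, h2]
  linarith

/-- The constant counts the four products in `gradedCommutator_eq`, each bounded by `‖A‖ * ‖B‖`. -/
theorem norm_gradedCommutator_le (A B : CARAlgebra) :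
    ‖gradedCommutator A B‖ ≤ 4 * ‖A‖ * ‖B‖ := by
  rw [gradedCommutator_eq]
  have h1 := norm_mul_le A (evenPart B)
  have h2 := norm_mul_le (evenPart B) A
  have h3 := norm_mul_le A (oddPart B)
  have h4 := norm_mul_le (oddPart B) (grading A)
  have h5 := norm_add_le (A * evenPart B - evenPart B * A) (A * oddPart B - oddPart B * grading A)
  have h6 := norm_sub_le (A * evenPart B) (evenPart B * A)
  have h7 := norm_sub_le (A * oddPart B) (oddPart B * grading A)
  rw [norm_aut] at h4
  have he := mul_le_mul_of_nonneg_left (norm_evenPart_le B) (norm_nonneg A)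
  have ho := mul_le_mul_of_nonneg_left (norm_oddPart_le B) (norm_nonneg A)
  nlinarith

theorem gradedCommutator_sub (A B C : CARAlgebra) :
    gradedCommutator A (B - C) = gradedCommutator A B - gradedCommutator A C := by
  have he : evenPart (B - C) = evenPart B - evenPart C := by
    simp only [evenPart, map_sub]; module
  have ho : oddPart (B - C) = oddPart B - oddPart C := by
    simp only [oddPart, map_sub]; module
  rw [gradedCommutator_eq, gradedCommutator_eq, gradedCommutator_eq, he, ho]
  noncomm_ring

/-! ### Flows on the CAR algebra -/

theorem CStarFlow.aut_floor_fract {A : Type*} [NormedRing A] [StarRing A] [NormedAlgebra ℂ A]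
    (α : CStarFlow A) (t : ℝ) (a : A) : α.aut t a = α.aut (⌊t⌋ : ℝ) (α.aut (Int.fract t) a) := by
  rw [← α.aut_add, Int.floor_add_fract]

theorem gradedAsymptoticallyAbelian_of_carShift (α : CStarFlow CARAlgebra)
    (hα : ∀ n : ℤ, α.aut (n : ℝ) = carShift n) : GradedAsymptoticallyAbelian α := by
  intro A B
  have h := tendsto_floor_fract (fun n C => ‖gradedCommutator A (carShift n C)‖) (4 * ‖A‖)
    (fun n x y => ?_) (fun _ _ => norm_nonneg _) (tendsto_gradedCommutator A) _
    (α.continuous_aut B)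
  · refine h.congr fun t => ?_
    rw [α.aut_floor_fract t, hα]
  · have h1 := norm_gradedCommutator_le A (carShift n (x - y))
    rw [norm_aut, map_sub, gradedCommutator_sub] at h1
    have h2 := norm_le_norm_add_norm_sub' (gradedCommutator A (carShift n x))
      (gradedCommutator A (carShift n y))
    linarith

/-! ### Limits of the sign automorphisms and the Jordan–Wigner strings -/

theorem tendsto_zero_mul_of_norm_le {ι R : Type*} [NormedRing R] {l : Filter ι} {x y : ι → R}
    {M : ℝ} (hx : Tendsto x l (𝓝 0)) (hy : ∀ i, ‖y i‖ ≤ M) :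
    Tendsto (fun i => x i * y i) l (𝓝 0) := by
  have h := hx.norm.mul_const M
  rw [norm_zero, zero_mul] at h
  exact squeeze_zero_norm (fun i => (norm_mul_le _ _).trans
    (mul_le_mul_of_nonneg_left (hy i) (norm_nonneg _))) h

theorem tendsto_mul_zero_of_norm_le {ι R : Type*} [NormedRing R] {l : Filter ι} {x y : ι → R}
    {M : ℝ} (hx : Tendsto x l (𝓝 0)) (hy : ∀ i, ‖y i‖ ≤ M) :
    Tendsto (fun i => y i * x i) l (𝓝 0) := by
  have h := hx.norm.const_mul M
  rw [norm_zero, mul_zero] at h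
  exact squeeze_zero_norm (fun i => (norm_mul_le _ _).trans
    (mul_le_mul_of_nonneg_right (hy i) (norm_nonneg _))) h

/-- With `1` as intertwiner, `tendsto_intertwine` says that pointwise convergence of automorphisms
may be checked on generators; there the two sides eventually agree. -/
theorem tendsto_signAut_sub {l : Filter ℤ} (f : ℤ → ℤ) (ψ : CARAlgebra ≃⋆ₐ[ℂ] CARAlgebra)
    (h : ∀ j, ∀ᶠ n in l, signAut (fun i => i ≤ f n) (c j) = ψ (c j)) (A : CARAlgebra) :
    Tendsto (fun n => signAut (fun i => i ≤ f n) A - ψ A) l (𝓝 0) := by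
  have := tendsto_intertwine (l := l) (fun n => signAut fun i => i ≤ f n) (fun _ => ψ)
    (fun _ => 1) ‖(1 : CARAlgebra)‖ (fun _ => le_rfl) (fun j => ?_) (fun j => ?_) A
  · simpa only [one_mul, mul_one] using this
  · refine tendsto_const_nhds.congr' ?_
    filter_upwards [h j] with n hn
    rw [hn, mul_one, one_mul, sub_self]
  · refine tendsto_const_nhds.congr' ?_
    filter_upwards [h j] with n hn
    rw [map_star, map_star, hn, mul_one, one_mul, sub_self]

theorem tendsto_signAut_atTop {l : Filter ℤ} {f : ℤ → ℤ} (hf : Tendsto f l atTop)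
    (A : CARAlgebra) :
    Tendsto (fun n => signAut (fun i => i ≤ f n) A - grading A) l (𝓝 0) := by
  refine tendsto_signAut_sub f grading (fun j => ?_) A
  filter_upwards [hf.eventually_ge_atTop j] with n hn
  rw [signAut_c, if_pos hn, grading_c]

theorem tendsto_signAut_atBot {l : Filter ℤ} {f : ℤ → ℤ} (hf : Tendsto f l atBot)
    (A : CARAlgebra) :
    Tendsto (fun n => signAut (fun i => i ≤ f n) A - A) l (𝓝 0) := by
  refine tendsto_signAut_sub f (.refl ℂ CARAlgebra) (fun j => ?_) A
  filter_upwards [hf.eventually_lt_atBot j] with n hn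
  rw [signAut_c, if_neg hn.not_ge]
  rfl

theorem norm_signOp_le (p : ℤ → Prop) [DecidablePred p] : ‖signOp p‖ ≤ 1 := by
  have h := CStarRing.norm_mul_coe_unitary (1 : Fock →L[ℂ] Fock) (signUnitary p)
  rw [one_mul, coe_signUnitary] at h
  exact h.trans_le ContinuousLinearMap.norm_id_le

theorem norm_jwString_le (n : ℤ) : ‖jwString (n + 1)‖ ≤ 1 := by
  change ‖(jwString (n + 1) : Fock →L[ℂ] Fock)‖ ≤ 1
  rw [coe_jwString, norm_smul, norm_zpow, norm_neg, norm_one, one_zpow, one_mul]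
  exact (norm_mul_le _ _).trans
    (mul_le_one₀ (norm_signOp_le _) (norm_nonneg _) (norm_signOp_le _))

/-- Up to sign the string is the product of the unitaries implementing `Θ_-` and `Θ_{≤n}`. Passing
it thus cancels `Θ_-` and leaves `Θ_{≤n}`. -/
theorem gradingMinus_mul_jwString (n : ℤ) (A : CARAlgebra) :
    gradingMinus A * jwString (n + 1) = jwString (n + 1) * signAut (fun i => i ≤ n) A := by
  refine Subtype.ext ?_
  rw [MulMemClass.coe_mul, MulMemClass.coe_mul, gradingMinus, coe_signAut, coe_signAut,
    coe_jwString, mul_smul_comm, smul_mul_assoc]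
  congr 1
  calc _ = signOp (fun i => i ≤ 0) * (A : Fock →L[ℂ] Fock) *
        (signOp (fun i => i ≤ 0) * signOp (fun i => i ≤ 0)) * signOp (fun i => i ≤ n) := by
        simp only [mul_assoc]
    _ = signOp (fun i => i ≤ 0) * (signOp (fun i => i ≤ n) * signOp (fun i => i ≤ n)) *
        (A : Fock →L[ℂ] Fock) * signOp (fun i => i ≤ n) := by
        rw [signOp_mul_self, signOp_mul_self, mul_one, mul_one]
    _ = _ := by simp only [mul_assoc]

theorem gradingMinus_jwString (n : ℤ) : gradingMinus (jwString (n + 1)) = jwString (n + 1) := by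
  refine Subtype.ext ?_
  rw [gradingMinus, coe_signAut, coe_jwString, mul_smul_comm, smul_mul_assoc]
  congr 1
  rw [← mul_assoc, signOp_mul_self, one_mul, signOp_comm]

/-- The cut at `0`, seen from the translated frame, is the cut at `-n`. -/
theorem gradingMinus_carShift (n : ℤ) (A : CARAlgebra) :
    gradingMinus (carShift n A) = carShift n (signAut (fun i => i ≤ -n) A) := by
  refine Subtype.ext ?_
  have h : signOp (fun i => i ≤ 0) = shiftOp n * signOp (fun i => i ≤ -n) * shiftOp (-n) := by
    rw [shiftOp_conj_signOp]; congr 1; ext i; simp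
  have h0 : ∀ x, shiftOp (-n) * (shiftOp n * x) = x := fun x => by
    rw [← mul_assoc, shiftOp_mul, neg_add_cancel, shiftOp_zero, one_mul]
  rw [gradingMinus, coe_signAut, coe_carShift, coe_carShift, coe_signAut, h]
  simp only [mul_assoc, h0]

/-! ### The commutator in the crossed product and its limits -/

theorem embed_add_T_mul (A B A' B' : CARAlgebra) :
    (embed A + T * embed B) * (embed A' + T * embed B') =
      embed (A * A' + gradingMinus B * B') + T * embed (gradingMinus A * B' + B * A') := by
  simp only [map_add, map_mul, ← T_conj_embed, mul_add, add_mul]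
  have h : T * (T * embed A * T * embed B') = embed A * (T * embed B') := by
    simp only [← mul_assoc, T_mul_T, one_mul]
  rw [h]
  simp only [mul_assoc]; abel

set_option maxHeartbeats 1600000 in
/-- The commutator of a spin observable with a translate of another one, in terms of its even and
odd components in the CAR algebra. -/
theorem commutator_spin (n : ℤ) (A B A' B' : CARAlgebra) :
    (embed A + T * embed B) * (embed (carShift n A') +
        T * embed (jwString (n + 1) * carShift n B')) -
      (embed (carShift n A') + T * embed (jwString (n + 1) * carShift n B')) *
        (embed A + T * embed B) =
    embed ((A * carShift n A' - carShift n A' * A) + jwString (n + 1) *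
        (signAut (fun i => i ≤ n) B * carShift n B' -
          carShift n (signAut (fun i => i ≤ -n) B') * B)) +
      T * embed (jwString (n + 1) * (signAut (fun i => i ≤ n) A * carShift n B' -
          carShift n B' * A) +
        (B * carShift n A' - carShift n (signAut (fun i => i ≤ -n) A') * B)) := by
  have h1 : gradingMinus B * (jwString (n + 1) * carShift n B') =
      jwString (n + 1) * (signAut (fun i => i ≤ n) B * carShift n B') := by
    rw [← mul_assoc, gradingMinus_mul_jwString, mul_assoc]
  have h2 : gradingMinus A * (jwString (n + 1) * carShift n B') =
      jwString (n + 1) * (signAut (fun i => i ≤ n) A * carShift n B') := by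
    rw [← mul_assoc, gradingMinus_mul_jwString, mul_assoc]
  have h3 : gradingMinus (jwString (n + 1) * carShift n B') * B =
      jwString (n + 1) * (carShift n (signAut (fun i => i ≤ -n) B') * B) := by
    rw [map_mul, gradingMinus_jwString, gradingMinus_carShift, mul_assoc]
  rw [embed_add_T_mul, embed_add_T_mul, h1, h2, h3, gradingMinus_carShift, mul_sub, mul_sub,
    mul_assoc]
  simp only [map_add, map_sub, mul_add, mul_sub]
  abel

theorem tendsto_carShift_zero {l : Filter ℤ} {x : ℤ → CARAlgebra} (hx : Tendsto x l (𝓝 0)) :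
    Tendsto (fun n => carShift n (x n)) l (𝓝 0) := by
  rw [tendsto_zero_iff_norm_tendsto_zero] at hx ⊢
  exact hx.congr fun n => (norm_aut _ _).symm

set_option maxHeartbeats 1600000 in
-- Replacing `s n` by `u • B` and `s' n` by `-u • B'` leaves `u` times the anticommutator of `B`
-- with the translate of `B'`, which tends to zero. The opposite signs are essential.
theorem tendsto_odd_odd {l : Filter ℤ} (hl : l ≤ cofinite) (u : ℂ) {B B' : CARAlgebra}
    (hB : grading B = -B) (hB' : grading B' = -B') {s s' : ℤ → CARAlgebra}
    (hs : Tendsto (fun n => s n - u • B) l (𝓝 0)) (hs' : Tendsto (fun n => s' n + u • B') l (𝓝 0)) :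
    Tendsto (fun n => s n * carShift n B' - carShift n (s' n) * B) l (𝓝 0) := by
  have t1 := tendsto_zero_mul_of_norm_le hs (fun n => (norm_aut (carShift n) B').le)
  have t2 := (tendsto_carShift_zero hs').mul_const B
  have t3 := ((tendsto_comm_odd B hB').mono_left hl).const_smul u
  have t := (t1.sub t2).add t3
  rw [zero_mul, smul_zero, sub_zero, add_zero] at t
  refine t.congr fun n => ?_
  rw [hB, map_add, map_smul, mul_neg, sub_neg_eq_add, sub_mul, add_mul, smul_add,
    smul_mul_assoc, smul_mul_assoc]
  abel

theorem tendsto_even_odd {l : Filter ℤ} (hl : l ≤ cofinite) {A B' : CARAlgebra}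
    (hA : grading A = A) (hB' : grading B' = -B') {s : ℤ → CARAlgebra}
    (hs : Tendsto (fun n => s n - A) l (𝓝 0)) :
    Tendsto (fun n => s n * carShift n B' - carShift n B' * A) l (𝓝 0) := by
  have t1 := tendsto_zero_mul_of_norm_le hs (fun n => (norm_aut (carShift n) B').le)
  have t := t1.add ((tendsto_comm_odd A hB').mono_left hl)
  rw [add_zero] at t
  refine t.congr fun n => ?_
  rw [hA, sub_mul]
  abel

theorem tendsto_any_even {l : Filter ℤ} (hl : l ≤ cofinite) (B : CARAlgebra) {A' : CARAlgebra}
    (hA' : grading A' = A') {s' : ℤ → CARAlgebra}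
    (hs' : Tendsto (fun n => s' n - A') l (𝓝 0)) :
    Tendsto (fun n => B * carShift n A' - carShift n (s' n) * B) l (𝓝 0) := by
  have t := ((tendsto_comm_even B hA').mono_left hl).sub
    ((tendsto_carShift_zero hs').mul_const B)
  rw [zero_mul, sub_zero] at t
  refine t.congr fun n => ?_
  rw [map_sub, sub_mul]
  abel

theorem continuous_embed : Continuous embed := by
  refine AddMonoidHomClass.continuous_of_bound embed 1 fun x => ?_
  rw [one_mul]
  have := isClosed_CARAlgebra
  exact NonUnitalStarAlgHom.norm_apply_le embed x

theorem tendsto_embed_add_T_mul {l : Filter ℤ} {x y : ℤ → CARAlgebra} (hx : Tendsto x l (𝓝 0))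
    (hy : Tendsto y l (𝓝 0)) : Tendsto (fun n => embed (x n) + T * embed (y n)) l (𝓝 0) := by
  have e := ((continuous_embed.tendsto 0).comp hx).add
    (((continuous_embed.tendsto 0).comp hy).const_mul T)
  rw [map_zero, mul_zero, add_zero] at e
  exact e

/-- This treats both ends of the chain at once: `u` is the sign that `B` acquires in the limit, and
`B'` acquires `-u`. The strings need not converge, but they have norm at most one and only multiply
terms that tend to zero. -/
theorem tendsto_commutator_spin_of_sign {l : Filter ℤ} (hl : l ≤ cofinite) (u : ℂ)
    {A B A' B' : CARAlgebra} (hA : grading A = A) (hB : grading B = -B) (hA' : grading A' = A')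
    (hB' : grading B' = -B')
    (h1 : Tendsto (fun n => signAut (fun i => i ≤ n) A - A) l (𝓝 0))
    (h2 : Tendsto (fun n => signAut (fun i => i ≤ n) B - u • B) l (𝓝 0))
    (h3 : Tendsto (fun n => signAut (fun i => i ≤ -n) A' - A') l (𝓝 0))
    (h4 : Tendsto (fun n => signAut (fun i => i ≤ -n) B' + u • B') l (𝓝 0)) :
    Tendsto (fun n => (embed A + T * embed B) * (embed (carShift n A') +
        T * embed (jwString (n + 1) * carShift n B')) -
      (embed (carShift n A') + T * embed (jwString (n + 1) * carShift n B')) *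
        (embed A + T * embed B)) l (𝓝 0) := by
  have e1 := ((tendsto_comm_even A hA').mono_left hl).add
    (tendsto_mul_zero_of_norm_le (tendsto_odd_odd hl u hB hB' h2 h4) norm_jwString_le)
  have e2 := (tendsto_mul_zero_of_norm_le (tendsto_even_odd hl hA hB' h1) norm_jwString_le).add
    (tendsto_any_even hl B hA' h3)
  rw [add_zero] at e1 e2
  exact (tendsto_embed_add_T_mul e1 e2).congr fun n => (commutator_spin n A B A' B').symm

theorem tendsto_commutator_spinShift (a b : spinAlgebra) :
    Tendsto (fun n => ‖a * spinShift n b - spinShift n b * a‖) cofinite (𝓝 0) := by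
  obtain ⟨_, A, B, hA, hB, rfl⟩ := a
  obtain ⟨_, A', B', hA', hB', rfl⟩ := b
  have key : Tendsto (fun n => (embed A + T * embed B) * (embed (carShift n A') +
        T * embed (jwString (n + 1) * carShift n B')) -
      (embed (carShift n A') + T * embed (jwString (n + 1) * carShift n B')) *
        (embed A + T * embed B)) cofinite (𝓝 0) := by
    have htop : Tendsto (fun n : ℤ => n) atTop atTop := tendsto_id
    have hbot : Tendsto (fun n : ℤ => n) atBot atBot := tendsto_id
    have ntop : Tendsto (fun n : ℤ => -n) atTop atBot := tendsto_neg_atTop_atBot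
    have nbot : Tendsto (fun n : ℤ => -n) atBot atTop := tendsto_neg_atBot_atTop
    rw [Int.cofinite_eq]
    refine Tendsto.sup ?_ ?_
    -- As `n → -∞`, the cut at `n` leaves `B` unchanged in the limit and the cut at `-n` flips `B'`,
    -- so `u = 1`.
    · refine tendsto_commutator_spin_of_sign (Int.cofinite_eq ▸ le_sup_left) 1 hA hB hA' hB'
        (tendsto_signAut_atBot hbot A) ?_ ?_ ?_
      · simpa only [one_smul] using tendsto_signAut_atBot hbot B
      · simpa only [hA'] using tendsto_signAut_atTop nbot A'
      · simpa only [hB', sub_neg_eq_add, one_smul] using tendsto_signAut_atTop nbot B'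
    -- As `n → +∞`, `B` is flipped and `B'` is not, so `u = -1`.
    · refine tendsto_commutator_spin_of_sign (Int.cofinite_eq ▸ le_sup_right) (-1) hA hB hA' hB'
        ?_ ?_ (tendsto_signAut_atBot ntop A') ?_
      · simpa only [hA] using tendsto_signAut_atTop htop A
      · simpa only [hB, neg_smul, one_smul] using tendsto_signAut_atTop htop B
      · simpa only [neg_smul, one_smul, ← sub_eq_add_neg] using tendsto_signAut_atBot ntop B'
  have h := key.norm
  rw [norm_zero] at h
  refine h.congr fun n => ?_
  rw [← spinShiftUnitary_conj n hA' hB']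
  rfl

/-! ### Flows on the spin algebra -/

theorem norm_spinShift (n : ℤ) (x : spinAlgebra) : ‖spinShift n x‖ = ‖x‖ := by
  change ‖(spinShift n x : MatOp)‖ = ‖(x : MatOp)‖
  rw [coe_spinShift, ← Unitary.coe_star, CStarRing.norm_mul_coe_unitary,
    CStarRing.norm_coe_unitary_mul]

theorem asymptoticallyAbelian_of_spinShift (α : CStarFlow spinAlgebra)
    (hα : ∀ n : ℤ, α.aut (n : ℝ) = spinShift n) : α.AsymptoticallyAbelian := by
  intro a b
  have h := tendsto_floor_fract (fun n x => ‖a * spinShift n x - spinShift n x * a‖) (2 * ‖a‖)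
    (fun n x y => ?_) (fun _ _ => norm_nonneg _) (tendsto_commutator_spinShift a) _
    (α.continuous_aut b)
  · refine h.congr fun t => ?_
    rw [α.aut_floor_fract t, hα]
  -- Linearity in the shifted element and isometry of the shift give the Lipschitz constant `2 *
  -- ‖a‖`, independent of `n`.
  · have e : a * spinShift n x - spinShift n x * a =
        (a * spinShift n y - spinShift n y * a) +
          (a * spinShift n (x - y) - spinShift n (x - y) * a) := by
      rw [map_sub, mul_sub, sub_mul]; abel
    have h1 := norm_mul_le a (spinShift n (x - y))
    have h2 := norm_mul_le (spinShift n (x - y)) a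
    rw [norm_spinShift] at h1 h2
    have h3 := norm_sub_le (a * spinShift n (x - y)) (spinShift n (x - y) * a)
    have h4 := norm_add_le (a * spinShift n y - spinShift n y * a)
      (a * spinShift n (x - y) - spinShift n (x - y) * a)
    rw [← e] at h4
    linarith

end QuantumChain

end

theorem proposition4p1 :
    (∀ α : QuantumChain.CStarFlow QuantumChain.spinAlgebra,
      (∀ n : ℤ, α.aut (n : ℝ) = QuantumChain.spinShift n) → α.AsymptoticallyAbelian) ∧
    (∀ α : QuantumChain.CStarFlow QuantumChain.CARAlgebra,
      (∀ n : ℤ, α.aut (n : ℝ) = QuantumChain.carShift n) →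
        QuantumChain.GradedAsymptoticallyAbelian α) := by
  exact ⟨QuantumChain.asymptoticallyAbelian_of_spinShift,
    QuantumChain.gradedAsymptoticallyAbelian_of_carShift⟩
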